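/- **Corollary 3.5 (Homotopy Uniqueness).** Let $n\ge 0$. *The category $\mathrm{Cob}(n)$.* Let $\alpha$ be a formal variable. Objects of $\mathrm{Cob}(n)$ are formally $q$-graded Temperley–Lieb diagrams $q^iD$ ($i\in\mathbb Z$), where $D$ is a planar diagram (possibly with closed circles) in a rectangle with $n$ boundary points at the bottom and $n$ at the top. Morphisms between such diagrams are $\mathbb Z[\alpha]$-linear combinations of dotted cobordisms embedded in the thickened rectangle, considered up to isotopy relative to the boundary and modulo the local relations: a sphere with $0,1,2,3$ dots equals $0,1,0,\alpha$ respectively, and (neck cutting) a tube around a disc equals the sum of the two ways of cutting it into two discs, one of which carries a dot. A cobordism $S:q^iA\to q^jB$ with $d$ dots and underlying surface $|S|$ has degree $\chi(|S|)-n-2d+(j-i)$, and $\alpha$ has degree $-4$; the morphisms $q^iA\to q^jB$ of $\mathrm{Cob}(n)$ are the combinations of degree $0$. Gluing diagrams vertically along $n$ boundary points, and cobordisms along $n$ boundary intervals, defines $\otimes$. Write $1$ for the identity diagram ($n$ vertical strands, in $q$-degree $0$), and $e_i$, $0<i<n$, for the diagram (in $q$-degree $0$) in which the $i$-th and $(i+1)$-st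 points are joined to each other both at the bottom and at the top and all other strands are vertical. *The category $\mathrm{Kom}(n)$* consists of the chain complexes $\cdots\to P_k\xrightarrow{d_k}P_{k+1}\to\cdots$ ($k\in\mathbb Z$) of finite formal direct sums of objects of $\mathrm{Cob}(n)$ (that is, over the additive category $\mathrm{Mat}(\mathrm{Cob}(n))$) such that $P_k=0$ for all sufficiently negative $k$. In particular all differentials, chain maps and homotopies are matrices of degree zero maps. *Universal projectors.* A complex $P\in\mathrm{Kom}(n)$ is a *universal projector* if 1. $P_k=0$ for $k<0$, and for $k>0$ every summand $q^iD$ of $P_k$ has $i\ge 0$ (and the differential consists of degree zero maps); 2. $P_0\cong 1$, and for $k>0$ no shifted copy of the identity diagram splits off $P_k$: $P_k\not\cong q^j1\oplus D$ for all $j\in\mathbb Z$ and all $D\in\mathrm{Mat}(\mathrm{Cob}(n))$; 3. $P\otimes e_i\simeq 0$ and $e_i\otimes P\simeq 0$ for all $0<i<n$. **Claim.** If $C,D\in\mathrm{Kom}(n)$ are universal projectors, then $C$ and $D$ are chain homotopy equivalent, $C\simeq D$ (by degree zero chain maps and homotopies). -/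

import Mathlib

open CategoryTheory CategoryTheory.Limits ZeroObject
open scoped Polynomial

noncomputable section

namespace BarNatan

/-! ### Temperley-Lieb diagrams

A planar diagram in a strip, in Morse position, is read from one side to the other as a word of
elementary pieces, each creating or joining one pair of adjacent strands.  Every planar diagram
(possibly with closed circles) is isotopic to such a word; planar isotopies between words are
recorded below as invertible cobordisms. -/

/-- An elementary planar piece from `a` points to `b` points (points are numbered from `0`).
`cup m i` creates two adjacent points, which get the numbers `i` and `i + 1`;
`cap m i` joins the adjacent points `i` and `i + 1`.  All other strands run straight through. -/
inductive Piece : ℕ → ℕ → Type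
  | cup (m i : ℕ) (h : i ≤ m) : Piece m (m + 2)
  | cap (m i : ℕ) (h : i ≤ m) : Piece (m + 2) m

/-- The strands of an elementary piece, as edges between points `(level, position)`, where the
piece runs from level `0` to level `1`. -/
inductive Piece.Edge : {a b : ℕ} → Piece a b → ℕ × ℕ → ℕ × ℕ → Prop
  | cup_left {m i : ℕ} {h : i ≤ m} (x : ℕ) (hx : x < i) : Edge (.cup m i h) (0, x) (1, x)
  | cup_right {m i : ℕ} {h : i ≤ m} (x : ℕ) (hx : i ≤ x) : Edge (.cup m i h) (0, x) (1, x + 2)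
  | cup_arc {m i : ℕ} {h : i ≤ m} : Edge (.cup m i h) (1, i) (1, i + 1)
  | cap_left {m i : ℕ} {h : i ≤ m} (x : ℕ) (hx : x < i) : Edge (.cap m i h) (0, x) (1, x)
  | cap_right {m i : ℕ} {h : i ≤ m} (x : ℕ) (hx : i ≤ x) : Edge (.cap m i h) (0, x + 2) (1, x)
  | cap_arc {m i : ℕ} {h : i ≤ m} : Edge (.cap m i h) (0, i) (0, i + 1)

/-- Planar diagrams from `a` points to `b` points, as words of elementary pieces. -/
inductive Diag : ℕ → ℕ → Type
  | nil (m : ℕ) : Diag m m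
  | cons {a b c : ℕ} (p : Piece a b) (D : Diag b c) : Diag a c

namespace Diag

/-- Stacking of diagrams. -/
def comp : {a b c : ℕ} → Diag a b → Diag b c → Diag a c
  | _, _, _, .nil _, E => E
  | _, _, _, .cons p D, E => .cons p (D.comp E)

@[simp] theorem nil_comp {a b : ℕ} (E : Diag a b) : (nil a).comp E = E := rfl

@[simp] theorem cons_comp {a b c d : ℕ} (p : Piece a b) (D : Diag b c) (E : Diag c d) :
    (cons p D).comp E = cons p (D.comp E) := rfl

@[simp] theorem comp_nil {a b : ℕ} (D : Diag a b) : D.comp (nil b) = D := by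
  induction D with
  | nil => rfl
  | cons p D ih => simp [ih]

@[simp] theorem comp_assoc {a b c d : ℕ} (D : Diag a b) (E : Diag b c) (F : Diag c d) :
    (D.comp E).comp F = D.comp (E.comp F) := by
  induction D with
  | nil => rfl
  | cons p D ih => simp [ih]

/-- The number of elementary pieces. -/
def length : {a b : ℕ} → Diag a b → ℕ
  | _, _, .nil _ => 0
  | _, _, .cons _ D => D.length + 1

/-- `(level, position)` is one of the points in which the diagram meets the horizontal lines
separating its pieces (including the two outer lines). -/
def IsPoint : {a b : ℕ} → Diag a b → ℕ × ℕ → Prop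
  | _, _, .nil m, v => v.1 = 0 ∧ v.2 < m
  | a, _, .cons _ D, v => (v.1 = 0 ∧ v.2 < a) ∨ ∃ w, D.IsPoint w ∧ v = (w.1 + 1, w.2)

/-- The strands of a diagram, as edges between its points.  The connected components of the
resulting graph are the arcs and the circles of the diagram. -/
def Edge : {a b : ℕ} → Diag a b → ℕ × ℕ → ℕ × ℕ → Prop
  | _, _, .nil _, _, _ => False
  | _, _, .cons p D, v, w => p.Edge v w ∨
      ∃ v' w', D.Edge v' w' ∧ v = (v'.1 + 1, v'.2) ∧ w = (w'.1 + 1, w'.2)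

/-- The diagram with one piece. -/
def cup (m i : ℕ) (h : i ≤ m) : Diag m (m + 2) := .cons (.cup m i h) (.nil _)

/-- The diagram with one piece. -/
def cap (m i : ℕ) (h : i ≤ m) : Diag (m + 2) m := .cons (.cap m i h) (.nil _)

/-- `m` vertical strands and a small circle between the strands `i - 1` and `i`. -/
def circ (m i : ℕ) (h : i ≤ m) : Diag m m := (cup m i h).comp (cap m i h)

/-- The turnback on `m + 2` strands: the points `i` and `i + 1` are joined to each other on
either side, all other strands are vertical. -/
def turnback (m i : ℕ) (h : i ≤ m) : Diag (m + 2) (m + 2) := (cap m i h).comp (cup m i h)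

end Diag

open Diag

/-- The elementary planar isotopies: straightening a strand, and exchanging the heights of two
pieces that lie side by side. -/
inductive Isotopy : {a b : ℕ} → Diag a b → Diag a b → Type
  | zigzag_left (m i : ℕ) (h : i < m) :
      Isotopy (.nil m) ((cup m i h.le).comp (cap m (i + 1) h))
  | zigzag_right (m i : ℕ) (h : i < m) :
      Isotopy (.nil m) ((cup m (i + 1) h).comp (cap m i h.le))
  | cup_cup (m i j : ℕ) (hij : i ≤ j) (hj : j ≤ m) :
      Isotopy ((cup m j hj).comp (cup (m + 2) i (by omega)))
        ((cup m i (hij.trans hj)).comp (cup (m + 2) (j + 2) (by omega)))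
  | cap_cap (m i j : ℕ) (hij : i ≤ j) (hj : j ≤ m) :
      Isotopy ((cap (m + 2) i (by omega)).comp (cap m j hj))
        ((cap (m + 2) (j + 2) (by omega)).comp (cap m i (hij.trans hj)))
  | cap_cup_left (m i j : ℕ) (hij : i ≤ j) (hj : j ≤ m) :
      Isotopy ((cap m j hj).comp (cup m i (hij.trans hj)))
        ((cup (m + 2) i (by omega)).comp (cap (m + 2) (j + 2) (by omega)))
  | cap_cup_right (m i j : ℕ) (hij : i ≤ j) (hj : j ≤ m) :
      Isotopy ((cap m i (hij.trans hj)).comp (cup m j hj))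
        ((cup (m + 2) (j + 2) (by omega)).comp (cap (m + 2) i (by omega)))

/-! ### Dotted cobordisms

A dotted cobordism is presented by a movie, a sequence of diagrams in which consecutive ones
differ by one elementary move. -/

/-- The elementary moves: birth and death of a circle, the two directions of a saddle, a dot on
the strand `i`, and the traces of planar isotopies. -/
inductive Elem : {a b : ℕ} → Diag a b → Diag a b → Type
  | birth (m i : ℕ) (h : i ≤ m) : Elem (.nil m) (circ m i h)
  | death (m i : ℕ) (h : i ≤ m) : Elem (circ m i h) (.nil m)
  | saddle (m i : ℕ) (h : i ≤ m) : Elem (.nil (m + 2)) (turnback m i h)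
  | saddle' (m i : ℕ) (h : i ≤ m) : Elem (turnback m i h) (.nil (m + 2))
  | dot (m i : ℕ) (h : i < m) : Elem (.nil m) (.nil m)
  | iso {a b : ℕ} {D E : Diag a b} (r : Isotopy D E) : Elem D E
  | isoInv {a b : ℕ} {D E : Diag a b} (r : Isotopy D E) : Elem E D

namespace Elem

/-- The Euler characteristic of the elementary cobordism relative to its source, and its number
of dots. -/
def weight : {a b : ℕ} → {D E : Diag a b} → Elem D E → ℤ × ℕ
  | _, _, _, _, .birth .. => (1, 0)
  | _, _, _, _, .death .. => (1, 0)
  | _, _, _, _, .saddle .. => (-1, 0)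
  | _, _, _, _, .saddle' .. => (-1, 0)
  | _, _, _, _, .dot .. => (0, 1)
  | _, _, _, _, .iso _ => (0, 0)
  | _, _, _, _, .isoInv _ => (0, 0)

/-- A point `(time, level, position)` on the component of the elementary cobordism that carries
the critical point or the dot; time `0` is the source, time `1` the target.
(For isotopies, whose weight is zero, there is none.) -/
def marker : {a b : ℕ} → {D E : Diag a b} → Elem D E → Option (ℕ × ℕ × ℕ)
  | _, _, _, _, .birth _ i _ => some (1, 1, i)
  | _, _, _, _, .death _ i _ => some (0, 1, i)
  | _, _, _, _, .saddle _ i _ => some (0, 0, i)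
  | _, _, _, _, .saddle' _ i _ => some (0, 0, i)
  | _, _, _, _, .dot _ i _ => some (0, 0, i)
  | _, _, _, _, .iso _ => none
  | _, _, _, _, .isoInv _ => none

end Elem

/-- An elementary move inside a larger diagram: it replaces the part `l` of `D = u l v` by `r`,
and is the identity cobordism on `u` and `v`. -/
structure Move {a d : ℕ} (D E : Diag a d) where
  {b c : ℕ}
  u : Diag a b
  {l r : Diag b c}
  elem : Elem l r
  v : Diag c d
  source_eq : D = u.comp (l.comp v)
  target_eq : E = u.comp (r.comp v)

namespace Move

/-- The vertical sheets of the cobordism: they connect the points of the source outside `l`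
(including its two ends) to the same points of the target. -/
def Sheet {a d : ℕ} {D E : Diag a d} (s : Move D E) (v w : ℕ × ℕ) : Prop :=
  v.2 = w.2 ∧ ((v.1 = w.1 ∧ v.1 ≤ s.u.length) ∨
    ∃ k, v.1 = s.u.length + s.l.length + k ∧ w.1 = s.u.length + s.r.length + k)

/-- The weight of the move together with a point on the component that carries it. -/
def marks {a d : ℕ} {D E : Diag a d} (s : Move D E) : List ((ℕ × ℕ × ℕ) × (ℤ × ℕ)) :=
  (s.elem.marker.map fun p => ((p.1, s.u.length + p.2.1, p.2.2), s.elem.weight)).toList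

/-- The topological degree: a dot has degree `-2`. -/
def deg {a d : ℕ} {D E : Diag a d} (s : Move D E) : ℤ :=
  s.elem.weight.1 - 2 * s.elem.weight.2

/-- Stacking a move with the identity of a diagram. -/
def left {a b c : ℕ} (U : Diag a b) {D E : Diag b c} (s : Move D E) :
    Move (U.comp D) (U.comp E) :=
  ⟨U.comp s.u, s.elem, s.v, by simp [← s.source_eq], by simp [← s.target_eq]⟩

/-- Stacking a move with the identity of a diagram. -/
def right {a b c : ℕ} {D E : Diag a b} (s : Move D E) (V : Diag b c) :
    Move (D.comp V) (E.comp V) :=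
  ⟨s.u, s.elem, s.v.comp V, by simp [s.source_eq], by simp [s.target_eq]⟩

end Move

/-- An elementary move on a whole diagram. -/
def Elem.toMove {a b : ℕ} {D E : Diag a b} (s : Elem D E) : Move D E :=
  ⟨.nil _, s, .nil _, by simp, by simp⟩

/-- A dot on the small circle. -/
def circDot (m i : ℕ) (h : i ≤ m) : Move (circ m i h) (circ m i h) :=
  ⟨cup m i h, .dot (m + 2) i (by omega), cap m i h, rfl, rfl⟩

/-- Movies. -/
inductive Movie {a b : ℕ} : Diag a b → Diag a b → Type
  | nil (D : Diag a b) : Movie D D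
  | cons {D E F : Diag a b} (s : Move D E) (M : Movie E F) : Movie D F

namespace Movie

section

variable {a b c : ℕ}

/-- Composition of movies. -/
def comp : {D E F : Diag a b} → Movie D E → Movie E F → Movie D F
  | _, _, _, .nil _, N => N
  | _, _, _, .cons s M, N => .cons s (M.comp N)

@[simp] theorem nil_comp {D E : Diag a b} (M : Movie D E) : (nil D).comp M = M := rfl

@[simp] theorem cons_comp {D E F G : Diag a b} (s : Move D E) (M : Movie E F) (N : Movie F G) :
    (cons s M).comp N = cons s (M.comp N) := rfl

@[simp] theorem comp_nil {D E : Diag a b} (M : Movie D E) : M.comp (nil E) = M := by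
  induction M with
  | nil => rfl
  | cons s M ih => simp [ih]

@[simp] theorem comp_assoc {D E F G : Diag a b} (M : Movie D E) (N : Movie E F)
    (P : Movie F G) : (M.comp N).comp P = M.comp (N.comp P) := by
  induction M with
  | nil => rfl
  | cons s M ih => simp [ih]

/-- Stacking a movie with the identity of a diagram. -/
def left (U : Diag a b) : {D E : Diag b c} → Movie D E → Movie (U.comp D) (U.comp E)
  | _, _, .nil D => .nil (U.comp D)
  | _, _, .cons s M => .cons (s.left U) (M.left U)

/-- Stacking a movie with the identity of a diagram. -/
def right : {D E : Diag a b} → Movie D E → (V : Diag b c) → Movie (D.comp V) (E.comp V)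
  | _, _, .nil D, V => .nil (D.comp V)
  | _, _, .cons s M, V => .cons (s.right V) (M.right V)

theorem left_comp (U : Diag a b) {D E F : Diag b c} (M : Movie D E) (N : Movie E F) :
    (M.comp N).left U = (M.left U).comp (N.left U) := by
  induction M with
  | nil => rfl
  | cons s M ih => simp [left, ih]

theorem right_comp {D E F : Diag a b} (M : Movie D E) (N : Movie E F) (V : Diag b c) :
    (M.comp N).right V = (M.right V).comp (N.right V) := by
  induction M with
  | nil => rfl
  | cons s M ih => simp [right, ih]

/-- The topological degree of the cobordism, `χ - n` when there are no dots; each dot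
contributes `-2`. -/
def deg : {D E : Diag a b} → Movie D E → ℤ
  | _, _, .nil _ => 0
  | _, _, .cons s M => s.deg + M.deg

theorem deg_comp {D E F : Diag a b} (M : Movie D E) (N : Movie E F) :
    (M.comp N).deg = M.deg + N.deg := by
  induction M with
  | nil => simp [deg]
  | cons s M ih => simp [deg, ih, add_assoc]

theorem deg_left (U : Diag a b) {D E : Diag b c} (M : Movie D E) : (M.left U).deg = M.deg := by
  induction M with
  | nil => rfl
  | cons s M ih => simp only [left, deg, ih]; rfl

theorem deg_right {D E : Diag a b} (M : Movie D E) (V : Diag b c) :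
    (M.right V).deg = M.deg := by
  induction M with
  | nil => rfl
  | cons s M ih => simp only [right, deg, ih]; rfl

/-- The number of moves. -/
def length : {D E : Diag a b} → Movie D E → ℕ
  | _, _, .nil _ => 0
  | _, _, .cons _ M => M.length + 1

/-- `(time, level, position)` is a point of one of the diagrams of the movie. -/
def IsPoint : {D E : Diag a b} → Movie D E → ℕ × ℕ × ℕ → Prop
  | _, _, .nil D, p => p.1 = 0 ∧ D.IsPoint p.2
  | D, _, .cons _ M, p => (p.1 = 0 ∧ D.IsPoint p.2) ∨ ∃ q, M.IsPoint q ∧ p = (q.1 + 1, q.2)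

/-- Two points of the surface swept out by the movie are joined by a strand of one of the
diagrams, or by a vertical sheet between consecutive diagrams. -/
def Edge : {D E : Diag a b} → Movie D E → ℕ × ℕ × ℕ → ℕ × ℕ × ℕ → Prop
  | _, _, .nil D, p, q => p.1 = 0 ∧ q.1 = 0 ∧ D.Edge p.2 q.2
  | D, _, .cons s M, p, q =>
      (p.1 = 0 ∧ q.1 = 0 ∧ D.Edge p.2 q.2) ∨ (p.1 = 0 ∧ q.1 = 1 ∧ s.Sheet p.2 q.2) ∨
        ∃ p' q', M.Edge p' q' ∧ p = (p'.1 + 1, p'.2) ∧ q = (q'.1 + 1, q'.2)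

/-- All weights of the moves of the movie, with points on the components that carry them. -/
def marks : {D E : Diag a b} → Movie D E → List ((ℕ × ℕ × ℕ) × (ℤ × ℕ))
  | _, _, .nil _ => []
  | _, _, .cons s M => s.marks ++ M.marks.map fun k => ((k.1.1 + 1, k.1.2), k.2)

/-- The points of the surface that are used to keep track of its components (every component
contains some of them). -/
def Point {D E : Diag a b} (M : Movie D E) : Type := {p : ℕ × ℕ × ℕ // M.IsPoint p}

/-- Two points lie on the same component of the surface. -/
def connected {D E : Diag a b} (M : Movie D E) : Setoid M.Point :=
  Relation.EqvGen.setoid fun p q => M.Edge p.1 q.1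

/-- The connected components of the surface swept out by the movie. -/
def Component {D E : Diag a b} (M : Movie D E) : Type := Quotient M.connected

/-- The point `p` lies on the component `κ`. -/
def Component.Contains {D E : Diag a b} {M : Movie D E} (κ : M.Component) (p : ℕ × ℕ × ℕ) :
    Prop :=
  ∃ h : M.IsPoint p, Quotient.mk M.connected ⟨p, h⟩ = κ

open Classical in
/-- The Euler characteristic of a component relative to its part in the source diagram, and its
number of dots. -/
def Component.weight {D E : Diag a b} {M : Movie D E} (κ : M.Component) : ℤ × ℕ :=
  ((M.marks.filter fun k => κ.Contains k.1).map fun k => k.2).sum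

/-- Two movies sweep out dotted surfaces that are homeomorphic relative to the boundary: there is
a bijection between the components that respects the boundary points on them, the Euler
characteristics and the numbers of dots. By the classification of surfaces (all surfaces
here are orientable, being embedded in space) this determines the dotted surface. -/
def Homeomorphic {D E : Diag a b} (M N : Movie D E) : Prop :=
  ∃ φ : M.Component ≃ N.Component,
    (∀ κ v, D.IsPoint v → (κ.Contains (0, v) ↔ (φ κ).Contains (0, v))) ∧
    (∀ κ v, E.IsPoint v → (κ.Contains (M.length, v) ↔ (φ κ).Contains (N.length, v))) ∧
    ∀ κ, (φ κ).weight = κ.weight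

end

end Movie

/-! ### The linear category of dotted cobordisms -/

/-- The ground ring `ℤ[α]`, with `α` the polynomial variable. -/
abbrev Ground : Type := ℤ[X]

/-- Formal linear combinations of movies. -/
abbrev FreeHom {a b : ℕ} (D E : Diag a b) : Type := Movie D E →₀ Ground

/-- A movie as a formal linear combination. -/
def single {a b : ℕ} {D E : Diag a b} (M : Movie D E) : FreeHom D E := Finsupp.single M 1

/-- The movie of one move. -/
def Move.movie {a b : ℕ} {D E : Diag a b} (s : Move D E) : Movie D E := .cons s (.nil E)

/-- The birth of a small circle. -/
def birth (m i : ℕ) (h : i ≤ m) : Movie (.nil m) (circ m i h) := (Elem.birth m i h).toMove.movie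

/-- The death of a small circle. -/
def death (m i : ℕ) (h : i ≤ m) : Movie (circ m i h) (.nil m) := (Elem.death m i h).toMove.movie

/-- The sphere with `k` dots. -/
def sphere (m i : ℕ) (h : i ≤ m) (k : ℕ) : Movie (.nil m) (.nil m) :=
  (birth m i h).comp (Nat.iterate (fun M => .cons (circDot m i h) M) k (death m i h))

/-- The defining relations between formal combinations of dotted cobordisms: homeomorphic
dotted surfaces are equal (the relations `iso_inv`, `inv_iso` and `interchange` are instances of
this: an isotopy can be undone, and moves in different parts of a diagram may be exchanged in
time); the spheres with `0`, `1`, `2`, `3` dots are `0`, `1`, `0`, `α`; a tube around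
a small circle is cut into two discs, one of them dotted (neck cutting).  All relations are
local: they may be applied inside larger cobordisms. -/
inductive Relator : {a b : ℕ} → {D E : Diag a b} → FreeHom D E → Prop
  | homeo {a b : ℕ} {D E : Diag a b} (M N : Movie D E) (h : M.Homeomorphic N) :
      Relator (single M - single N)
  | iso_inv {a b : ℕ} {D E : Diag a b} (r : Isotopy D E) :
      Relator (single ((Elem.iso r).toMove.movie.comp (Elem.isoInv r).toMove.movie) -
        single (.nil D))
  | inv_iso {a b : ℕ} {D E : Diag a b} (r : Isotopy D E) :
      Relator (single ((Elem.isoInv r).toMove.movie.comp (Elem.iso r).toMove.movie) -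
        single (.nil E))
  | interchange {a b c : ℕ} {D D' : Diag a b} {E E' : Diag b c} (s : Move D D')
      (t : Move E E') :
      Relator (single ((s.right E).movie.comp (t.left D').movie) -
        single ((t.left D).movie.comp (s.right E').movie))
  | sphere_zero (m i : ℕ) (h : i ≤ m) : Relator (single (sphere m i h 0))
  | sphere_one (m i : ℕ) (h : i ≤ m) :
      Relator (single (sphere m i h 1) - single (.nil (.nil m)))
  | sphere_two (m i : ℕ) (h : i ≤ m) : Relator (single (sphere m i h 2))
  | sphere_three (m i : ℕ) (h : i ≤ m) :
      Relator (single (sphere m i h 3) - (Polynomial.X : Ground) • single (.nil (.nil m)))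
  | neck (m i : ℕ) (h : i ≤ m) :
      Relator (single (.nil (circ m i h)) -
        (single ((circDot m i h).movie.comp ((death m i h).comp (birth m i h))) +
          single ((death m i h).comp ((birth m i h).comp (circDot m i h).movie))))
  | pre {a b : ℕ} {D E F : Diag a b} (M : Movie D E) {x : FreeHom E F} (hx : Relator x) :
      Relator (Finsupp.lmapDomain Ground Ground (fun N => M.comp N) x)
  | post {a b : ℕ} {D E F : Diag a b} {x : FreeHom D E} (hx : Relator x) (N : Movie E F) :
      Relator (Finsupp.lmapDomain Ground Ground (fun M => M.comp N) x)
  | left {a b c : ℕ} (U : Diag a b) {D E : Diag b c} {x : FreeHom D E} (hx : Relator x) :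
      Relator (Finsupp.lmapDomain Ground Ground (fun M => M.left U) x)
  | right {a b c : ℕ} {D E : Diag a b} {x : FreeHom D E} (hx : Relator x) (V : Diag b c) :
      Relator (Finsupp.lmapDomain Ground Ground (fun M => M.right V) x)

/-- The submodule spanned by the relations. -/
def relations {a b : ℕ} (D E : Diag a b) : Submodule Ground (FreeHom D E) :=
  Submodule.span Ground {x | Relator x}

/-- The module of dotted cobordisms (of arbitrary degree) from `D` to `E`. -/
abbrev CobHom {a b : ℕ} (D E : Diag a b) : Type := FreeHom D E ⧸ relations D E

section

variable {a b c : ℕ}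

/-- The class of a movie. -/
def cls {D E : Diag a b} (M : Movie D E) : CobHom D E := (relations D E).mkQ (single M)

/-- Composition of formal combinations. -/
def freeComp (D E F : Diag a b) : FreeHom D E →ₗ[Ground] FreeHom E F →ₗ[Ground] FreeHom D F :=
  Finsupp.linearCombination Ground fun M => Finsupp.lmapDomain Ground Ground fun N => M.comp N

theorem freeComp_single {D E F : Diag a b} (M : Movie D E) (N : Movie E F) :
    freeComp D E F (single M) (single N) = single (M.comp N) := by
  simp [freeComp, single]

theorem freeComp_mem_right {D E F : Diag a b} (x : FreeHom D E) {y : FreeHom E F}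
    (hy : y ∈ relations E F) : freeComp D E F x y ∈ relations D F := by
  induction x using Finsupp.induction_linear with
  | zero => simp
  | add x x' hx hx' => simpa using add_mem hx hx'
  | single M r =>
    have h : Finsupp.lmapDomain Ground Ground (fun N => M.comp N) y ∈ relations D F := by
      induction hy using Submodule.span_induction with
      | mem y hy => exact Submodule.subset_span (Relator.pre M hy)
      | zero => simp
      | add y y' _ _ h h' => rw [map_add]; exact add_mem h h'
      | smul r y _ h => rw [map_smul]; exact Submodule.smul_mem _ _ h
    simpa [freeComp] using Submodule.smul_mem _ r h

theorem freeComp_mem_left {D E F : Diag a b} {x : FreeHom D E} (hx : x ∈ relations D E)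
    (y : FreeHom E F) : freeComp D E F x y ∈ relations D F := by
  induction y using Finsupp.induction_linear with
  | zero => simp
  | add y y' hy hy' => rw [map_add]; exact add_mem hy hy'
  | single N r =>
    have h : Finsupp.lmapDomain Ground Ground (fun M => M.comp N) x ∈ relations D F := by
      induction hx using Submodule.span_induction with
      | mem y hy => exact Submodule.subset_span (Relator.post hy N)
      | zero => simp
      | add y y' _ _ h h' => rw [map_add]; exact add_mem h h'
      | smul r y _ h => rw [map_smul]; exact Submodule.smul_mem _ _ h
    have e : freeComp D E F x (Finsupp.single N r) =
        r • Finsupp.lmapDomain Ground Ground (fun M => M.comp N) x := by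
      clear h hx
      induction x using Finsupp.induction_linear with
      | zero => simp
      | add x x' hx hx' => simp only [map_add, LinearMap.add_apply, smul_add, hx, hx']
      | single M s => simp [freeComp, mul_comm]
    rw [e]
    exact Submodule.smul_mem _ r h

/-- Composition of dotted cobordisms. -/
def cobComp (D E F : Diag a b) : CobHom D E →ₗ[Ground] CobHom E F →ₗ[Ground] CobHom D F :=
  (relations D E).liftQ
    { toFun := fun x => (relations E F).mapQ (relations D F) (freeComp D E F x)
        fun _ hy => freeComp_mem_right x hy
      map_add' := fun x x' => by ext; simp
      map_smul' := fun r x => by ext; simp }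
    (fun x hx => by
      rw [LinearMap.mem_ker]
      apply LinearMap.ext
      intro y
      obtain ⟨y, rfl⟩ := (relations E F).mkQ_surjective y
      exact (Submodule.Quotient.mk_eq_zero _).2 (freeComp_mem_left hx y))

theorem cobComp_cls {D E F : Diag a b} (M : Movie D E) (N : Movie E F) :
    cobComp D E F (cls M) (cls N) = cls (M.comp N) :=
  congrArg (relations D F).mkQ (freeComp_single M N)

/-- Dotted cobordisms are linear combinations of classes of movies. -/
theorem cobHom_induction {D E : Diag a b} {P : CobHom D E → Prop} (f : CobHom D E)
    (zero : P 0) (add : ∀ f g, P f → P g → P (f + g))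
    (smul : ∀ (r : Ground) (M : Movie D E), P (r • cls M)) : P f := by
  obtain ⟨x, rfl⟩ := (relations D E).mkQ_surjective f
  induction x using Finsupp.induction_linear with
  | zero => simpa using zero
  | add x x' hx hx' => rw [map_add]; exact add _ _ hx hx'
  | single M r =>
    have h : (Finsupp.single M r : FreeHom D E) = r • single M := by simp [single]
    rw [h, map_smul]
    exact smul r M

theorem cls_nil_comp {D E : Diag a b} (f : CobHom D E) :
    cobComp D D E (cls (.nil D)) f = f := by
  induction f using cobHom_induction with
  | zero => simp
  | add f g hf hg => rw [map_add, hf, hg]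
  | smul r M => rw [map_smul, cobComp_cls, Movie.nil_comp]

theorem comp_cls_nil {D E : Diag a b} (f : CobHom D E) :
    cobComp D E E f (cls (.nil E)) = f := by
  induction f using cobHom_induction with
  | zero => simp
  | add f g hf hg => rw [map_add, LinearMap.add_apply, hf, hg]
  | smul r M => rw [map_smul, LinearMap.smul_apply, cobComp_cls, Movie.comp_nil]

theorem cobComp_assoc {D E F G : Diag a b} (f : CobHom D E) (g : CobHom E F)
    (h : CobHom F G) :
    cobComp D F G (cobComp D E F f g) h = cobComp D E G f (cobComp E F G g h) := by
  induction f using cobHom_induction with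
  | zero => simp
  | add f f' hf hf' => simp only [map_add, LinearMap.add_apply, hf, hf']
  | smul r M =>
    induction g using cobHom_induction with
    | zero => simp
    | add g g' hg hg' => simp only [map_add, LinearMap.add_apply, hg, hg']
    | smul s N =>
      induction h using cobHom_induction with
      | zero => simp
      | add h h' hh hh' => simp only [map_add, hh, hh']
      | smul t P =>
        simp only [map_smul, LinearMap.smul_apply, cobComp_cls, Movie.comp_assoc]

/-- Gluing a dotted cobordism with the identity of a diagram. -/
def cobLeft (U : Diag a b) (D E : Diag b c) :
    CobHom D E →ₗ[Ground] CobHom (U.comp D) (U.comp E) :=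
  (relations D E).mapQ _ (Finsupp.lmapDomain Ground Ground fun M => M.left U)
    (Submodule.span_le.2 fun _ hx => Submodule.subset_span (Relator.left U hx))

/-- Gluing a dotted cobordism with the identity of a diagram. -/
def cobRight (D E : Diag a b) (V : Diag b c) :
    CobHom D E →ₗ[Ground] CobHom (D.comp V) (E.comp V) :=
  (relations D E).mapQ _ (Finsupp.lmapDomain Ground Ground fun M => M.right V)
    (Submodule.span_le.2 fun _ hx => Submodule.subset_span (Relator.right hx V))

theorem cobLeft_cls (U : Diag a b) {D E : Diag b c} (M : Movie D E) :
    cobLeft U D E (cls M) = cls (M.left U) :=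
  congrArg (relations _ _).mkQ (Finsupp.mapDomain_single (f := fun M : Movie D E => M.left U)
    (b := (1 : Ground)))

theorem cobRight_cls {D E : Diag a b} (M : Movie D E) (V : Diag b c) :
    cobRight D E V (cls M) = cls (M.right V) :=
  congrArg (relations _ _).mkQ (Finsupp.mapDomain_single (f := fun M : Movie D E => M.right V)
    (b := (1 : Ground)))

theorem cobLeft_comp (U : Diag a b) {D E F : Diag b c} (f : CobHom D E) (g : CobHom E F) :
    cobLeft U D F (cobComp D E F f g) = cobComp _ _ _ (cobLeft U D E f) (cobLeft U E F g) := by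
  induction f using cobHom_induction with
  | zero => simp
  | add f f' hf hf' => simp only [map_add, LinearMap.add_apply, hf, hf']
  | smul r M =>
    induction g using cobHom_induction with
    | zero => simp
    | add g g' hg hg' => simp only [map_add, hg, hg']
    | smul s N =>
      simp only [map_smul, LinearMap.smul_apply, cobComp_cls, cobLeft_cls, Movie.left_comp]

theorem cobRight_comp {D E F : Diag a b} (f : CobHom D E) (g : CobHom E F) (V : Diag b c) :
    cobRight D F V (cobComp D E F f g) =
      cobComp _ _ _ (cobRight D E V f) (cobRight E F V g) := by
  induction f using cobHom_induction with
  | zero => simp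
  | add f f' hf hf' => simp only [map_add, LinearMap.add_apply, hf, hf']
  | smul r M =>
    induction g using cobHom_induction with
    | zero => simp
    | add g g' hg hg' => simp only [map_add, hg, hg']
    | smul s N =>
      simp only [map_smul, LinearMap.smul_apply, cobComp_cls, cobRight_cls, Movie.right_comp]

/-- The dotted cobordisms of topological degree `d`: integral combinations of `α ^ k` times
a dotted surface, where `α`, being the value of a sphere with three dots, has degree `-4`. -/
def homogeneous (D E : Diag a b) (d : ℤ) : AddSubgroup (CobHom D E) :=
  AddSubgroup.closure
    {f | ∃ (k : ℕ) (M : Movie D E), M.deg - 4 * k = d ∧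
      f = (Polynomial.X ^ k : Ground) • cls M}

theorem homogeneous_id (D : Diag a b) : cls (.nil D) ∈ homogeneous D D 0 :=
  AddSubgroup.subset_closure ⟨0, .nil D, by simp [Movie.deg], by simp⟩

theorem homogeneous_comp {D E F : Diag a b} {d e : ℤ} {f : CobHom D E} {g : CobHom E F}
    (hf : f ∈ homogeneous D E d) (hg : g ∈ homogeneous E F e) :
    cobComp D E F f g ∈ homogeneous D F (d + e) := by
  induction hf using AddSubgroup.closure_induction with
  | zero => simp [zero_mem]
  | add f f' _ _ h h' => rw [map_add]; exact add_mem h h'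
  | neg f _ h => rw [map_neg]; exact neg_mem h
  | mem f hf =>
    obtain ⟨k, M, hM, rfl⟩ := hf
    induction hg using AddSubgroup.closure_induction with
    | zero => simp [zero_mem]
    | add g g' _ _ h h' => rw [map_add]; exact add_mem h h'
    | neg g _ h => rw [map_neg]; exact neg_mem h
    | mem g hg =>
      obtain ⟨l, N, hN, rfl⟩ := hg
      refine AddSubgroup.subset_closure ⟨k + l, M.comp N, ?_, ?_⟩
      · rw [Movie.deg_comp, ← hM, ← hN]; push_cast; ring
      · rw [map_smul, map_smul, LinearMap.smul_apply, cobComp_cls, smul_smul, pow_add, mul_comm]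

theorem homogeneous_left (U : Diag a b) {D E : Diag b c} {d : ℤ} {f : CobHom D E}
    (hf : f ∈ homogeneous D E d) : cobLeft U D E f ∈ homogeneous (U.comp D) (U.comp E) d := by
  induction hf using AddSubgroup.closure_induction with
  | zero => simp [zero_mem]
  | add f f' _ _ h h' => rw [map_add]; exact add_mem h h'
  | neg f _ h => rw [map_neg]; exact neg_mem h
  | mem f hf =>
    obtain ⟨k, M, hM, rfl⟩ := hf
    exact AddSubgroup.subset_closure
      ⟨k, M.left U, by rw [Movie.deg_left, hM], by rw [map_smul, cobLeft_cls]⟩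

theorem homogeneous_right {D E : Diag a b} {d : ℤ} {f : CobHom D E}
    (hf : f ∈ homogeneous D E d) (V : Diag b c) :
    cobRight D E V f ∈ homogeneous (D.comp V) (E.comp V) d := by
  induction hf using AddSubgroup.closure_induction with
  | zero => simp [zero_mem]
  | add f f' _ _ h h' => rw [map_add]; exact add_mem h h'
  | neg f _ h => rw [map_neg]; exact neg_mem h
  | mem f hf =>
    obtain ⟨k, M, hM, rfl⟩ := hf
    exact AddSubgroup.subset_closure
      ⟨k, M.right V, by rw [Movie.deg_right, hM], by rw [map_smul, cobRight_cls]⟩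

end

/-! ### The graded category, complexes, and universal projectors -/

/-- The objects `q ^ i D`: a diagram with `n + n` boundary points and a formal `q`-degree. -/
structure Cob (n : ℕ) where
  diag : Diag n n
  q : ℤ

variable {n : ℕ}

/-- The morphisms `q ^ i D ⟶ q ^ j E` are the dotted cobordisms of degree zero, i.e. those for
which the topological degree and the `q`-degree `j - i` add up to zero. -/
instance : Category (Cob n) where
  Hom A B := homogeneous A.diag B.diag (A.q - B.q)
  id A := ⟨cls (.nil A.diag), by rw [sub_self]; exact homogeneous_id A.diag⟩
  comp {A B C} f g := ⟨cobComp _ _ _ f.1 g.1, by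
    have h := homogeneous_comp f.2 g.2
    rwa [sub_add_sub_cancel] at h⟩
  id_comp f := Subtype.ext (cls_nil_comp f.1)
  comp_id f := Subtype.ext (comp_cls_nil f.1)
  assoc f g h := Subtype.ext (cobComp_assoc f.1 g.1 h.1)

instance : Preadditive (Cob n) where
  homGroup A B := inferInstanceAs (AddCommGroup (homogeneous A.diag B.diag (A.q - B.q)))
  add_comp _ _ _ f f' g := Subtype.ext (LinearMap.map_add₂ (cobComp _ _ _) f.1 f'.1 g.1)
  comp_add _ _ _ f g g' := Subtype.ext (map_add (cobComp _ _ _ f.1) g.1 g'.1)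

/-- The functor `U ⊗ -` on graded diagrams. -/
def stackLeft (U : Diag n n) : Cob n ⥤ Cob n where
  obj A := ⟨U.comp A.diag, A.q⟩
  map f := ⟨cobLeft U _ _ f.1, homogeneous_left U f.2⟩
  map_id A := Subtype.ext (cobLeft_cls U (.nil A.diag))
  map_comp f g := Subtype.ext (cobLeft_comp U f.1 g.1)

/-- The functor `- ⊗ V` on graded diagrams. -/
def stackRight (V : Diag n n) : Cob n ⥤ Cob n where
  obj A := ⟨A.diag.comp V, A.q⟩
  map f := ⟨cobRight _ _ V f.1, homogeneous_right f.2 V⟩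
  map_id A := Subtype.ext (cobRight_cls (.nil A.diag) V)
  map_comp f g := Subtype.ext (cobRight_comp f.1 g.1 V)

instance (U : Diag n n) : (stackLeft U).Additive where
  map_add {_ _ f g} := Subtype.ext (map_add (cobLeft U _ _) f.1 g.1)

instance (V : Diag n n) : (stackRight V).Additive where
  map_add {_ _ f g} := Subtype.ext (map_add (cobRight _ _ V) f.1 g.1)

/-- The additive category `Mat(Cob(n))` of finite formal direct sums. -/
abbrev MatCob (n : ℕ) : Type 1 := Mat_ (Cob n)

instance (F : Cob n ⥤ Cob n) [F.Additive] : F.mapMat_.Additive where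
  map_add {_ _ f g} := by
    apply Mat_.hom_ext
    intro i j
    exact F.map_add

instance : HasBinaryBiproducts (MatCob n) := hasBinaryBiproducts_of_finite_biproducts _

instance : HasZeroObject (MatCob n) := hasZeroObject_of_hasFiniteBiproducts (MatCob n)

/-- The chain complexes `⋯ ⟶ K_k ⟶ K_{k+1} ⟶ ⋯` in `Mat(Cob(n))` that vanish in all
sufficiently negative homological degrees. -/
def boundedBelow (n : ℕ) : ObjectProperty (CochainComplex (MatCob n) ℤ) :=
  fun K => ∃ N : ℤ, ∀ k < N, IsZero (K.X k)

/-- The category `Kom(n)`. -/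
abbrev Kom (n : ℕ) : Type 1 := (boundedBelow n).FullSubcategory

/-- The object `q ^ j 1`, the identity diagram in `q`-degree `j`. -/
def unit (n : ℕ) (j : ℤ) : MatCob n := (Mat_.embedding (Cob n)).obj ⟨.nil n, j⟩

/-- The generator `e_i` of the Temperley-Lieb algebra, for `0 < i < n`: it joins the `i`-th
and the `(i + 1)`-st point (counted from `1`) on either side. -/
def gen : (n i : ℕ) → 0 < i → i < n → Diag n n
  | 0, _, _, h => absurd h (by omega)
  | 1, _, _, h => absurd h (by omega)
  | m + 2, i, _, h => turnback m (i - 1) (by omega)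

/-- The complex `e ⊗ K`. -/
def tensorLeft (e : Diag n n) (K : CochainComplex (MatCob n) ℤ) : CochainComplex (MatCob n) ℤ :=
  ((stackLeft e).mapMat_.mapHomologicalComplex (ComplexShape.up ℤ)).obj K

/-- The complex `K ⊗ e`. -/
def tensorRight (K : CochainComplex (MatCob n) ℤ) (e : Diag n n) : CochainComplex (MatCob n) ℤ :=
  ((stackRight e).mapMat_.mapHomologicalComplex (ComplexShape.up ℤ)).obj K

/-- A complex is contractible if it is homotopy equivalent to zero. -/
def IsContractible (K : CochainComplex (MatCob n) ℤ) : Prop :=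
  Nonempty (HomotopyEquiv K (0 : CochainComplex (MatCob n) ℤ))

/-- Universal projectors.  (That the differential consists of degree zero maps is part of the
definition of the category `Cob n`.) -/
structure IsUniversalProjector (P : Kom n) : Prop where
  isZero_of_neg : ∀ k < 0, IsZero (P.obj.X k)
  q_nonneg : ∀ k > 0, ∀ s : (P.obj.X k).ι, 0 ≤ ((P.obj.X k).X s).q
  zero_iso : Nonempty (P.obj.X 0 ≅ unit n 0)
  /-- No shifted copy of the identity diagram is a summand in positive homological degree. -/
  not_iso : ∀ k > 0, ∀ (j : ℤ) (D : MatCob n), IsEmpty (P.obj.X k ≅ unit n j ⊞ D)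
  right_contractible : ∀ (i : ℕ) (h₀ : 0 < i) (h₁ : i < n),
    IsContractible (tensorRight P.obj (gen n i h₀ h₁))
  left_contractible : ∀ (i : ℕ) (h₀ : 0 < i) (h₁ : i < n),
    IsContractible (tensorLeft (gen n i h₀ h₁) P.obj)

end BarNatan

end

open CategoryTheory CategoryTheory.Limits ZeroObject
open scoped Polynomial

noncomputable section

namespace BarNatan

open Diag

/-! A universal projector behaves like an injective resolution of the identity diagram, and
uniqueness is the comparison theorem for such resolutions. The role of injectivity is played by
acyclicity: if `C` and `D` are universal projectors, then `Hom(C, D_k)` is acyclic for every `k >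
0`, and likewise for the other three pairings. The isomorphism `C_0 ≅ 1 ≅ D_0` then extends degree
by degree to chain maps both ways (`exists_hom_extending`). Each composite minus the identity
vanishes in degree `0`, hence is null-homotopic (`nonempty_homotopy_zero`).

Acyclicity is checked on summands of `D_k`. Delooping circles, straightening strands and moving caps
before cups rewrites every diagram as a sum of shifts of one word of caps followed by cups
(`exists_splitting_isNormal`). With `n` points at both ends, such a word is either the identity,
which is excluded because it would split off `D_k`, or begins with a cap.

For a diagram `Z` beginning with the cap of a turnback `e`, the saddle `Z → q(e ⊗ Z)` followed by
the death of the circle in `e ⊗ Z` is the identity (`cls_snake`, `saddle_death`). The saddle is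
natural, so a cocycle `C_p → Z` factors through its image under `e ⊗ -`. There it is a coboundary,
since `e ⊗ C` is contractible (`homExact_of_retract`). -/

/-! ### Extending chain maps and homotopies -/

section

universe v u

variable {A : Type u} [Category.{v} A] [Preadditive A]

/-- The contravariant complex of maps from `K` to `Z` is exact. -/
def HomExact (K : CochainComplex A ℤ) (Z : A) : Prop :=
  ∀ (p : ℤ) (φ : K.X p ⟶ Z), (∀ j, K.d j p ≫ φ = 0) →
    ∃ ψ : K.X (p + 1) ⟶ Z, K.d p (p + 1) ≫ ψ = φ

/-- A cocycle is solved after projection to each `Y i`, and the solutions are recombined through the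
inclusions. Only the decomposition of the identity matters; orthogonality plays no role. -/
theorem HomExact.of_sum {K : CochainComplex A ℤ} {Z : A} {ι : Type*} [Fintype ι] {Y : ι → A}
    (g : ∀ i, Z ⟶ Y i) (f : ∀ i, Y i ⟶ Z) (h : ∑ i, g i ≫ f i = 𝟙 Z)
    (hY : ∀ i, HomExact K (Y i)) : HomExact K Z := by
  intro p φ hφ
  have hψ i : ∃ ψ : K.X (p + 1) ⟶ Y i, K.d p (p + 1) ≫ ψ = φ ≫ g i :=
    hY i p (φ ≫ g i) fun j => by rw [← Category.assoc, hφ, zero_comp]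
  choose ψ hψ using hψ
  refine ⟨∑ i, ψ i ≫ f i, ?_⟩
  simp_rw [Preadditive.comp_sum, ← Category.assoc, hψ, Category.assoc, ← Preadditive.comp_sum, h,
    Category.comp_id]

variable {K L : CochainComplex A ℤ}

/-- The usual comparison argument: once `f` is known in degree `k`, the map `f_k ≫ d` is a cocycle
with values in `L_{k+1}`, and exactness there supplies `f_{k+1}`. -/
theorem exists_hom_extending (hK : ∀ k < 0, IsZero (K.X k))
    (h : ∀ k > 0, HomExact K (L.X k)) (f₀ : K.X 0 ⟶ L.X 0) : ∃ f : K ⟶ L, f.f 0 = f₀ := by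
  -- The recursion carries the cocycle condition along with the map, since the next extension
  -- problem needs it.
  let S (k : ℕ) : Type v :=
    {f : K.X k ⟶ L.X k // ∀ j, K.d j k ≫ f ≫ L.d k (k + 1) = 0}
  have step (k : ℕ) (f : S k) :
      ∃ g : S (k + 1), K.d k (k + 1) ≫ g.1 = f.1 ≫ L.d k (k + 1) := by
    obtain ⟨ψ, hψ⟩ := h (k + 1) (by omega) k (f.1 ≫ L.d k (k + 1)) f.2
    refine ⟨⟨ψ, fun j => ?_⟩, hψ⟩
    by_cases hj : j + 1 = ((k + 1 : ℕ) : ℤ)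
    · obtain rfl : j = k := by push_cast at hj; omega
      refine (Category.assoc _ _ _).symm.trans ?_
      refine (congrArg (· ≫ L.d (k + 1) (k + 1 + 1)) hψ).trans ?_
      rw [Category.assoc, L.d_comp_d, comp_zero]
    · rw [K.shape j _ hj, zero_comp]
  choose next hnext using step
  let s (k : ℕ) : S k := Nat.rec ⟨f₀, fun j => by
    by_cases hj : j + 1 = 0
    · exact (hK j (by omega)).eq_of_src _ _
    · exact (congrArg (· ≫ _) (K.shape j 0 hj)).trans zero_comp⟩ (fun k f => next k f) k
  let f : ∀ k : ℤ, K.X k ⟶ L.X k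
    | .ofNat k => (s k).1
    | .negSucc _ => 0
  refine ⟨⟨f, ?_⟩, rfl⟩
  rintro i j (rfl : i + 1 = j)
  cases i with
  | ofNat k => exact (hnext k (s k)).symm
  | negSucc k => exact (hK _ (Int.negSucc_lt_zero k)).eq_of_src _ _

/-- The homotopy component out of `K_{k+2}` solves `d ≫ s_{k+1} = f_{k+1} - s_k ≫ d`, whose right
side is a cocycle by the choice of `s_k`. Because `f_0 = 0`, the recursion can start with `s_0 = 0`,
so exactness for maps into `L_0` is never required. -/
theorem nonempty_homotopy_zero (hK : ∀ k < 0, IsZero (K.X k))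
    (h : ∀ k > 0, HomExact K (L.X k)) (f : K ⟶ L) (hf : f.f 0 = 0) :
    Nonempty (Homotopy f 0) := by
  let S (k : ℕ) : Type v :=
    {s : K.X (k + 1) ⟶ L.X k // ∀ j, K.d j (k + 1) ≫ (f.f (k + 1) - s ≫ L.d k (k + 1)) = 0}
  have step (k : ℕ) (s : S k) : ∃ t : S (k + 1),
      K.d (k + 1) (k + 1 + 1) ≫ t.1 = f.f (k + 1) - s.1 ≫ L.d k (k + 1) := by
    obtain ⟨ψ, hψ⟩ := h (k + 1) (by omega) (k + 1) _ s.2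
    refine ⟨⟨ψ, fun j => ?_⟩, hψ⟩
    push_cast
    by_cases hj : j + 1 = ((k : ℤ) + 1 + 1)
    · obtain rfl : j = k + 1 := by omega
      rw [Preadditive.comp_sub, ← Category.assoc]
      refine (congrArg (fun x => _ - x ≫ _) hψ).trans ?_
      rw [Preadditive.sub_comp, Category.assoc, L.d_comp_d, comp_zero, sub_zero, f.comm, sub_self]
    · rw [K.shape j _ hj, zero_comp]
  choose next hnext using step
  let s (k : ℕ) : S k := Nat.rec ⟨0, fun j => by
    by_cases hj : j + 1 = ((0 : ℕ) : ℤ) + 1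
    · obtain rfl : j = 0 := by push_cast at hj; omega
      rw [zero_comp, sub_zero]
      refine (f.comm _ _).symm.trans ?_
      rw [hf, zero_comp]
    · rw [K.shape j _ hj, zero_comp]⟩ (fun k f => next k f) k
  let t : ∀ k : ℤ, K.X (k + 1) ⟶ L.X k
    | .ofNat k => (s k).1
    | .negSucc _ => 0
  let t' (i j : ℤ) (hij : (ComplexShape.up ℤ).Rel j i) : K.X i ⟶ L.X j :=
    eqToHom (congrArg K.X (Eq.symm hij)) ≫ t j
  have ht' (j : ℤ) : t' (j + 1) j rfl = t j := Category.id_comp _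
  have key : Homotopy.nullHomotopicMap' t' = f := by
    ext k
    obtain ⟨j, rfl⟩ : ∃ j, k = j + 1 := ⟨k - 1, by omega⟩
    rw [Homotopy.nullHomotopicMap'_f (c := ComplexShape.up ℤ) (k₂ := j) (k₁ := j + 1)
      (k₀ := j + 1 + 1) rfl rfl, ht', ht']
    -- Positive degrees `j + 1` are the recursion. Degree `0` is the case `j = -1`, where both
    -- homotopy terms vanish by choice, as does `f`. Below that `K` is zero.
    rcases j with k | (_ | k)
    · refine (congrArg (· + t k ≫ L.d k (k + 1)) (hnext k (s k))).trans ?_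
      exact sub_add_cancel _ _
    · refine Eq.trans ?_ hf.symm
      exact (congrArg₂ (· + ·) comp_zero zero_comp).trans (add_zero _)
    · exact (hK _ (by omega)).eq_of_src _ _
  exact ⟨(Homotopy.ofEq key.symm).trans (Homotopy.nullHomotopy' t')⟩

/-- Extending `e.hom` and `e.inv` exactly in degree `0` makes both differences `f ≫ g - 𝟙` and `g ≫
f - 𝟙` vanish there, which is what the null-homotopy needs. -/
theorem nonempty_homotopyEquiv (hK : ∀ k < 0, IsZero (K.X k)) (hL : ∀ k < 0, IsZero (L.X k))
    (hKK : ∀ k > 0, HomExact K (K.X k)) (hKL : ∀ k > 0, HomExact K (L.X k))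
    (hLK : ∀ k > 0, HomExact L (K.X k)) (hLL : ∀ k > 0, HomExact L (L.X k))
    (e : K.X 0 ≅ L.X 0) : Nonempty (HomotopyEquiv K L) := by
  obtain ⟨f, hf⟩ := exists_hom_extending hK hKL e.hom
  obtain ⟨g, hg⟩ := exists_hom_extending hL hLK e.inv
  obtain ⟨s⟩ := nonempty_homotopy_zero hK hKK (f ≫ g - 𝟙 K) (by simp [hf, hg])
  obtain ⟨t⟩ := nonempty_homotopy_zero hL hLL (g ≫ f - 𝟙 L) (by simp [hf, hg])
  exact ⟨⟨f, g, Homotopy.equivSubZero.symm s, Homotopy.equivSubZero.symm t⟩⟩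

/-- The complement is the biproduct of the remaining `Y i`; the orthogonality relations make `Z` a
binary biproduct of it with `Y i₀`. -/
theorem nonempty_iso_biprod [HasFiniteBiproducts A] [HasBinaryBiproducts A] {Z : A} {ι : Type}
    [Fintype ι] [DecidableEq ι] {Y : ι → A}
    (p : ∀ i, Z ⟶ Y i) (s : ∀ i, Y i ⟶ Z) (total : ∑ i, p i ≫ s i = 𝟙 Z)
    (self : ∀ i, s i ≫ p i = 𝟙 (Y i)) (ne : ∀ i j, i ≠ j → s i ≫ p j = 0) (i₀ : ι) :
    ∃ D : A, Nonempty (Z ≅ Y i₀ ⊞ D) := by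
  let b : BinaryBicone (Y i₀) (⨁ fun i : {i // i ≠ i₀} => Y i) :=
    { pt := Z
      fst := p i₀
      snd := biproduct.lift fun i => p i
      inl := s i₀
      inr := biproduct.desc fun i => s i
      inl_fst := self i₀
      inl_snd := by
        ext i
        simpa using ne _ _ i.2.symm
      inr_fst := by
        ext i
        simpa using ne _ _ i.2
      inr_snd := by
        ext j i
        by_cases hij : i = j
        · subst hij
          simpa using self i
        · simpa [biproduct.ι_π_ne _ hij] using ne _ _ fun h => hij (Subtype.ext h) }
  have hb : b.IsBilimit := isBinaryBilimitOfTotal b (by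
    change p i₀ ≫ s i₀ + biproduct.lift (fun i : {i // i ≠ i₀} => p i) ≫
      biproduct.desc (fun i : {i // i ≠ i₀} => s i) = 𝟙 Z
    rw [biproduct.lift_desc, ← total, ← Fintype.sum_subtype_add_sum_subtype (· = i₀)]
    exact congrArg (· + _) (by simp; rfl))
  exact ⟨_, ⟨biprod.uniqueUpToIso _ _ hb⟩⟩

end

/-! ### Delooping and normal forms of diagrams -/

section

variable {a b c : ℕ}

theorem cls_mem_homogeneous {D E : Diag a b} (M : Movie D E) : cls M ∈ homogeneous D E M.deg :=
  AddSubgroup.subset_closure ⟨0, M, by simp, by simp⟩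

/-- `W` is isomorphic to a nonempty finite direct sum of graded shifts of `W'`. -/
structure Splitting (W W' : Diag a b) where
  ι : Type
  [fintype : Fintype ι]
  [nonempty : Nonempty ι]
  d : ι → ℤ
  proj : ι → CobHom W W'
  incl : ι → CobHom W' W
  proj_mem : ∀ k, proj k ∈ homogeneous W W' (d k)
  incl_mem : ∀ k, incl k ∈ homogeneous W' W (-d k)
  total : ∑ k, cobComp W W' W (proj k) (incl k) = cls (.nil W)
  self : ∀ k, cobComp W' W W' (incl k) (proj k) = cls (.nil W')
  ne : ∀ k l, k ≠ l → cobComp W' W W' (incl k) (proj l) = 0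

namespace Splitting

attribute [instance] Splitting.fintype Splitting.nonempty

/-- An isomorphism of degree zero. -/
def ofIso {W W' : Diag a b} (M : Movie W W') (N : Movie W' W) (hM : M.deg = 0) (hN : N.deg = 0)
    (h : cls (M.comp N) = cls (.nil W)) (h' : cls (N.comp M) = cls (.nil W')) :
    Splitting W W' where
  ι := Unit
  d _ := 0
  proj _ := cls M
  incl _ := cls N
  proj_mem _ := hM ▸ cls_mem_homogeneous M
  incl_mem _ := by simpa [hN] using cls_mem_homogeneous N
  total := by simpa [cobComp_cls] using h
  self _ := by simpa [cobComp_cls] using h'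
  ne _ _ h := absurd rfl h

/-- The trivial splitting. -/
def refl (W : Diag a b) : Splitting W W := ofIso (.nil W) (.nil W) rfl rfl rfl rfl

/-- A splitting of the splitting summand. -/
def trans {W W' W'' : Diag a b} (S : Splitting W W') (T : Splitting W' W'') :
    Splitting W W'' where
  ι := S.ι × T.ι
  d k := S.d k.1 + T.d k.2
  proj k := cobComp _ _ _ (S.proj k.1) (T.proj k.2)
  incl k := cobComp _ _ _ (T.incl k.2) (S.incl k.1)
  proj_mem k := homogeneous_comp (S.proj_mem _) (T.proj_mem _)
  incl_mem k := by
    rw [neg_add_rev]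
    exact homogeneous_comp (T.incl_mem _) (S.incl_mem _)
  total := by
    rw [Fintype.sum_prod_type, ← S.total]
    refine Finset.sum_congr rfl fun i _ => ?_
    have h (j : T.ι) : cobComp W W'' W (cobComp W W' W'' (S.proj i) (T.proj j))
        (cobComp W'' W' W (T.incl j) (S.incl i)) = cobComp W W' W (S.proj i)
          (cobComp W' W' W (cobComp W' W'' W' (T.proj j) (T.incl j)) (S.incl i)) := by
      simp only [cobComp_assoc]
    simp only [h]
    rw [← map_sum, ← LinearMap.sum_apply, ← map_sum, T.total, cls_nil_comp]
  self k := by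
    rw [cobComp_assoc, ← cobComp_assoc (S.incl _), S.self, cls_nil_comp, T.self]
  ne k l h := by
    rw [cobComp_assoc, ← cobComp_assoc (S.incl _)]
    by_cases h₁ : k.1 = l.1
    · rw [h₁, S.self, cls_nil_comp, T.ne _ _ fun h₂ => h (Prod.ext h₁ h₂)]
    · rw [S.ne _ _ h₁, map_zero, LinearMap.zero_apply, map_zero]

/-- Stacking a splitting with the identity of a diagram. -/
def left (U : Diag a b) {W W' : Diag b c} (S : Splitting W W') :
    Splitting (U.comp W) (U.comp W') where
  ι := S.ι
  d := S.d
  proj k := cobLeft U _ _ (S.proj k)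
  incl k := cobLeft U _ _ (S.incl k)
  proj_mem k := homogeneous_left U (S.proj_mem k)
  incl_mem k := homogeneous_left U (S.incl_mem k)
  total := by simp only [← cobLeft_comp, ← map_sum, S.total, cobLeft_cls, Movie.left]
  self k := by simp only [← cobLeft_comp, S.self, cobLeft_cls, Movie.left]
  ne k l h := by simp only [← cobLeft_comp, S.ne k l h, map_zero]

/-- Stacking a splitting with the identity of a diagram. -/
def right {W W' : Diag a b} (S : Splitting W W') (V : Diag b c) :
    Splitting (W.comp V) (W'.comp V) where
  ι := S.ι
  d := S.d
  proj k := cobRight _ _ V (S.proj k)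
  incl k := cobRight _ _ V (S.incl k)
  proj_mem k := homogeneous_right (S.proj_mem k) V
  incl_mem k := homogeneous_right (S.incl_mem k) V
  total := by simp only [← cobRight_comp, ← map_sum, S.total, cobRight_cls, Movie.right]
  self k := by simp only [← cobRight_comp, S.self, cobRight_cls, Movie.right]
  ne k l h := by simp only [← cobRight_comp, S.ne k l h, map_zero]

end Splitting

theorem cls_eq_of_relator {D E : Diag a b} {M N : Movie D E} (h : Relator (single M - single N)) :
    cls M = cls N := by
  have : (relations D E).mkQ (single M - single N) = 0 :=
    (Submodule.Quotient.mk_eq_zero _).2 (Submodule.subset_span h)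
  rwa [map_sub, sub_eq_zero] at this

theorem cls_eq_zero_of_relator {D E : Diag a b} {M : Movie D E} (h : Relator (single M)) :
    cls M = 0 :=
  (Submodule.Quotient.mk_eq_zero _).2 (Submodule.subset_span h)

theorem neck_cutting (m i : ℕ) (h : i ≤ m) :
    cls (.nil (circ m i h)) =
      cls ((circDot m i h).movie.comp ((death m i h).comp (birth m i h))) +
        cls ((death m i h).comp ((birth m i h).comp (circDot m i h).movie)) := by
  have : (relations _ _).mkQ (single (.nil (circ m i h)) -
        (single ((circDot m i h).movie.comp ((death m i h).comp (birth m i h))) +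
          single ((death m i h).comp ((birth m i h).comp (circDot m i h).movie)))) = 0 :=
    (Submodule.Quotient.mk_eq_zero _).2 (Submodule.subset_span (Relator.neck m i h))
  rw [map_sub, map_add, sub_eq_zero] at this
  exact this

/-- An isotopy of diagrams. -/
def Isotopy.splitting {D E : Diag a b} (r : Isotopy D E) : Splitting D E :=
  .ofIso (Elem.iso r).toMove.movie (Elem.isoInv r).toMove.movie rfl rfl
    (cls_eq_of_relator (.iso_inv r)) (cls_eq_of_relator (.inv_iso r))

/-- An isotopy of diagrams, read backwards. -/
def Isotopy.splitting' {D E : Diag a b} (r : Isotopy D E) : Splitting E D :=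
  .ofIso (Elem.isoInv r).toMove.movie (Elem.iso r).toMove.movie rfl rfl
    (cls_eq_of_relator (.inv_iso r)) (cls_eq_of_relator (.iso_inv r))

/-- Delooping. -/
def circSplitting (m i : ℕ) (h : i ≤ m) : Splitting (circ m i h) (.nil m) where
  ι := Bool
  d k := bif k then -1 else 1
  proj k := bif k then cls ((circDot m i h).movie.comp (death m i h)) else cls (death m i h)
  incl k := bif k then cls (birth m i h) else cls ((birth m i h).comp (circDot m i h).movie)
  proj_mem := by
    rintro (_ | _)
    · exact cls_mem_homogeneous (death m i h)
    · exact cls_mem_homogeneous ((circDot m i h).movie.comp (death m i h))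
  incl_mem := by
    rintro (_ | _)
    · exact cls_mem_homogeneous ((birth m i h).comp (circDot m i h).movie)
    · exact cls_mem_homogeneous (birth m i h)
  -- Neck cutting is precisely the decomposition of the identity of the circle. The composites the
  -- other way are spheres: one dot on the diagonal, two or no dots off it.
  total := by
    rw [neck_cutting]
    simp [cobComp_cls]
  self := by
    rintro (_ | _) <;>
    · simp only [cond_true, cond_false, cobComp_cls]
      exact cls_eq_of_relator (.sphere_one m i h)
  ne := by
    rintro (_ | _) (_ | _) hkl
    · exact absurd rfl hkl
    · simp only [cond_true, cond_false, cobComp_cls]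
      exact cls_eq_zero_of_relator (.sphere_two m i h)
    · simp only [cond_true, cond_false, cobComp_cls]
      exact cls_eq_zero_of_relator (.sphere_zero m i h)
    · exact absurd rfl hkl

/-! ### Normal forms: caps before cups. -/

/-- A word of cups. -/
inductive IsCups : {a b : ℕ} → Diag a b → Prop
  | nil (m : ℕ) : IsCups (.nil m)
  | cons {m i b : ℕ} (h : i ≤ m) {D : Diag (m + 2) b} : IsCups D → IsCups (.cons (.cup m i h) D)

/-- A word of caps followed by cups. -/
inductive IsNormal : {a b : ℕ} → Diag a b → Prop
  | cups {a b : ℕ} {D : Diag a b} : IsCups D → IsNormal D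
  | cons {m i b : ℕ} (h : i ≤ m) {D : Diag m b} : IsNormal D → IsNormal (.cons (.cap m i h) D)

theorem IsCups.le {D : Diag a b} (h : IsCups D) : a ≤ b := by
  induction h with
  | nil => exact le_rfl
  | cons _ _ ih => omega

/-- Only a cup placed before a cap needs work. Such a pair either cancels, or is far apart and can
be exchanged, after which the cup meets a shorter normal word. -/
theorem IsNormal.exists_splitting_cons {D : Diag b c} (hD : IsNormal D) (p : Piece a b) :
    ∃ W, Nonempty (Splitting (.cons p D) W) ∧ IsNormal W := by
  induction hD generalizing a with
  | cups hD =>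
    cases p with
    | cup m i h => exact ⟨_, ⟨.refl _⟩, .cups (.cons h hD)⟩
    | cap m i h => exact ⟨_, ⟨.refl _⟩, .cons h (.cups hD)⟩
  | @cons m j c hj D hD ih =>
    cases p with
    | cap _ i h => exact ⟨_, ⟨.refl _⟩, .cons h (.cons hj hD)⟩
    | cup _ i hi =>
      -- Equal positions form a circle, neighbouring positions a zigzag, and positions at distance
      -- at least two leave disjoint pieces. In the last case the shift by `2` is the change of
      -- numbering across the other piece.
      obtain rfl | rfl | rfl | hij | hij :
        i = j ∨ j = i + 1 ∨ i = j + 1 ∨ i + 2 ≤ j ∨ j + 2 ≤ i := by omega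
      · exact ⟨D, ⟨(circSplitting m i hi).right D⟩, hD⟩
      · exact ⟨D, ⟨(Isotopy.zigzag_left m i hj).splitting'.right D⟩, hD⟩
      · exact ⟨D, ⟨(Isotopy.zigzag_right m j hi).splitting'.right D⟩, hD⟩
      · obtain ⟨m, rfl⟩ : ∃ k, m = k + 2 := ⟨m - 2, by omega⟩
        obtain ⟨j, rfl⟩ : ∃ k, j = k + 2 := ⟨j - 2, by omega⟩
        obtain ⟨W, ⟨S⟩, hW⟩ := ih (.cup m i (by omega))
        have hj' : j ≤ m := by omega
        have hij' : i ≤ j := by omega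
        exact ⟨_, ⟨((Isotopy.cap_cup_left m i j hij' hj').splitting'.right D).trans
          (S.left (cap m j hj'))⟩, .cons _ hW⟩
      · obtain ⟨m, rfl⟩ : ∃ k, m = k + 2 := ⟨m - 2, by omega⟩
        obtain ⟨i, rfl⟩ : ∃ k, i = k + 2 := ⟨i - 2, by omega⟩
        obtain ⟨W, ⟨S⟩, hW⟩ := ih (.cup m i (by omega))
        have hi' : i ≤ m := by omega
        have hij' : j ≤ i := by omega
        exact ⟨_, ⟨((Isotopy.cap_cup_right m j i hij' hi').splitting'.right D).trans
          (S.left (cap m j (hij'.trans hi')))⟩, .cons _ hW⟩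

theorem exists_splitting_isNormal (D : Diag a b) :
    ∃ W, Nonempty (Splitting D W) ∧ IsNormal W := by
  induction D with
  | nil m => exact ⟨_, ⟨.refl _⟩, .cups (.nil m)⟩
  | cons p D ih =>
    obtain ⟨W, ⟨S⟩, hW⟩ := ih
    obtain ⟨W', ⟨S'⟩, hW'⟩ := hW.exists_splitting_cons p
    exact ⟨W', ⟨(S.left (.cons p (.nil _))).trans S'⟩, hW'⟩

/-- The diagram begins with a cap. -/
inductive StartsWithCap : {a b : ℕ} → Diag a b → Prop
  | cons {m i b : ℕ} (h : i ≤ m) (D : Diag m b) : StartsWithCap (.cons (.cap m i h) D)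

/-- A nonempty word of cups increases the number of points, which is impossible between `a` and `a`;
so a normal word without caps is empty. -/
theorem IsNormal.eq_nil_or {D : Diag a a} (h : IsNormal D) : D = .nil a ∨ StartsWithCap D := by
  cases h with
  | cups h =>
    cases h with
    | nil => exact .inl rfl
    | cons _ h => exact absurd h.le (by omega)
  | cons h => exact .inr (.cons _ _)

end

/-! ### A saddle followed by the death of a circle -/

namespace Movie

section

variable {a b : ℕ}

/-- A labelling of the points of a movie whose values correspond to the components. -/
structure Labelling {D E : Diag a b} (M : Movie D E) (L : Type) where
  label : ℕ × ℕ × ℕ → L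
  rep : L → M.Point
  label_rep : ∀ l, label (rep l).1 = l
  label_eq : ∀ p q, M.Edge p q → label p = label q
  connected_rep : ∀ p : M.Point, M.connected p (rep (label p.1))

namespace Labelling

variable {D E : Diag a b} {M : Movie D E} {L : Type} (S : M.Labelling L)

theorem label_eq_of_connected {p q : M.Point} (h : M.connected p q) :
    S.label p.1 = S.label q.1 := by
  induction h with
  | rel p q h => exact S.label_eq _ _ h
  | refl => rfl
  | symm _ _ _ h => exact h.symm
  | trans _ _ _ _ _ h h' => exact h.trans h'

/-- The components correspond to the labels. -/
def equiv : M.Component ≃ L where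
  toFun := Quotient.lift (fun p => S.label p.1) fun _ _ h => S.label_eq_of_connected h
  invFun l := Quotient.mk _ (S.rep l)
  left_inv := by
    rintro ⟨p⟩
    exact Quotient.sound (M.connected.symm (S.connected_rep p))
  right_inv := S.label_rep

theorem contains_iff (κ : M.Component) (p : ℕ × ℕ × ℕ) :
    κ.Contains p ↔ M.IsPoint p ∧ S.label p = S.equiv κ := by
  constructor
  · rintro ⟨h, rfl⟩
    exact ⟨h, rfl⟩
  · rintro ⟨h, e⟩
    exact ⟨h, S.equiv.injective e⟩

end Labelling

/-- Movies with compatible labellings are homeomorphic. -/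
theorem Labelling.homeomorphic {D E : Diag a b} {M N : Movie D E} {L : Type}
    (S : M.Labelling L) (T : N.Labelling L)
    (hM₀ : ∀ v, D.IsPoint v → M.IsPoint (0, v)) (hN₀ : ∀ v, D.IsPoint v → N.IsPoint (0, v))
    (hM₁ : ∀ v, E.IsPoint v → M.IsPoint (M.length, v))
    (hN₁ : ∀ v, E.IsPoint v → N.IsPoint (N.length, v))
    (h₀ : ∀ v, D.IsPoint v → S.label (0, v) = T.label (0, v))
    (h₁ : ∀ v, E.IsPoint v → S.label (M.length, v) = T.label (N.length, v))
    (hw : ∀ κ κ', S.equiv κ = T.equiv κ' → κ'.weight = κ.weight) : M.Homeomorphic N := by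
  refine ⟨S.equiv.trans T.equiv.symm, fun κ v hv => ?_, fun κ v hv => ?_, fun κ => ?_⟩
  · rw [S.contains_iff, T.contains_iff, h₀ v hv]
    simp [hM₀ v hv, hN₀ v hv]
  · rw [S.contains_iff, T.contains_iff, h₁ v hv]
    simp [hM₁ v hv, hN₁ v hv]
  · exact hw _ _ (by simp)

end

end Movie

/-! ### Components of the snake surface. -/

section

variable (m i : ℕ) (h : i ≤ m)

/-- The movie in which a circle splits off a cap and dies. -/
def snake : Movie (cap m i h) (cap m i h) :=
  .cons (D := cap m i h) (E := (turnback m i h).comp (cap m i h))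
    ((Elem.saddle m i h).toMove.right (cap m i h))
    -- The word cap-cup-cap is read as a turnback followed by a cap for the saddle, and as a cap
    -- followed by a circle for the death; the two readings agree by definition.
    (.cons (D := (cap m i h).comp (circ m i h)) (E := cap m i h)
      ((Elem.death m i h).toMove.left (cap m i h)) (.nil (cap m i h)))

/-- The strand of the cap through a point, `none` being the arc. -/
def capLabel (v : ℕ × ℕ) : Option ℕ :=
  if v.1 % 2 = 1 then some v.2
  else if v.2 < i then some v.2 else if v.2 < i + 2 then none else some (v.2 - 2)

/-- The label depends on the level only through its parity, so one formula serves caps starting at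
even levels and, in the next lemma, cups starting at odd levels. -/
theorem capLabel_eq_of_edge {p q : ℕ × ℕ} (h' : (Piece.cap m i h).Edge p q) (k : ℕ) :
    capLabel i (p.1 + 2 * k, p.2) = capLabel i (q.1 + 2 * k, q.2) := by
  cases h' <;> simp [capLabel] <;> grind

theorem capLabel_eq_of_edge' {p q : ℕ × ℕ} (h' : (Piece.cup m i h).Edge p q) (k : ℕ) :
    capLabel i (p.1 + 2 * k + 1, p.2) = capLabel i (q.1 + 2 * k + 1, q.2) := by
  cases h' <;> simp [capLabel] <;> grind

theorem capLabel_of_edge_cap {p q : ℕ × ℕ} (h' : (cap m i h).Edge p q) :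
    capLabel i p = capLabel i q := by
  rcases h' with h' | ⟨_, _, h', _⟩
  · exact capLabel_eq_of_edge m i h h' 0
  · exact h'.elim

theorem capLabel_of_edge_cap_circ {p q : ℕ × ℕ}
    (h' : ((cap m i h).comp (circ m i h)).Edge p q) : capLabel i p = capLabel i q := by
  rcases h' with h' | ⟨v, w, h' | ⟨v', w', h' | ⟨_, _, h', _⟩, rfl, rfl⟩, rfl, rfl⟩
  · exact capLabel_eq_of_edge m i h h' 0
  · exact capLabel_eq_of_edge' m i h h' 0
  · exact capLabel_eq_of_edge m i h h' 1
  · exact h'.elim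

theorem isPoint_cap_iff (v : ℕ × ℕ) :
    (cap m i h).IsPoint v ↔ (v.1 = 0 ∧ v.2 < m + 2) ∨ (v.1 = 1 ∧ v.2 < m) := by
  obtain ⟨l, x⟩ := v
  simp [cap, IsPoint]
  grind

theorem isPoint_cap_circ_iff (v : ℕ × ℕ) : ((cap m i h).comp (circ m i h)).IsPoint v ↔
    (v.1 = 0 ∧ v.2 < m + 2) ∨ (v.1 = 1 ∧ v.2 < m) ∨ (v.1 = 2 ∧ v.2 < m + 2) ∨
      (v.1 = 3 ∧ v.2 < m) := by
  obtain ⟨l, x⟩ := v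
  simp [cap, cup, circ, IsPoint]
  grind

/-- The component of the cap through a point (a junk value outside the diagram). -/
def capComponent (v : ℕ × ℕ) : Option (Fin m) :=
  (capLabel i v).bind fun x => if hx : x < m then some ⟨x, hx⟩ else none

/-- A point on each component of the cap. -/
def capRep : Option (Fin m) → ℕ × ℕ
  | none => (0, i)
  | some x => (1, x)

theorem isPoint_capRep (l : Option (Fin m)) : (cap m i h).IsPoint (capRep m i l) := by
  rw [isPoint_cap_iff]
  cases l with
  | none => simp [capRep]; omega
  | some x => simp [capRep]

theorem capComponent_capRep (l : Option (Fin m)) : capComponent m i (capRep m i l) = l := by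
  cases l <;> simp [capRep, capComponent, capLabel]

variable {m i h}

theorem connected_of_edge {a b : ℕ} {D E : Diag a b} {M : Movie D E} {p q : M.Point}
    (h : M.Edge p.1 q.1) : M.connected p q := .rel _ _ h

/-- Stated for any movie starting at the cap, so that it applies both to the identity and to the
first frame of the snake. -/
theorem connected_capRep {E : Diag (m + 2) m} {M : Movie (cap m i h) E}
    (hP : ∀ v, (cap m i h).IsPoint v → M.IsPoint (0, v))
    (hE : ∀ v w, (cap m i h).Edge v w → M.Edge (0, v) (0, w)) (v : ℕ × ℕ)
    (hv : (cap m i h).IsPoint v) :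
    M.connected ⟨(0, v), hP v hv⟩
      ⟨(0, capRep m i (capComponent m i v)), hP _ (isPoint_capRep m i h _)⟩ := by
  obtain ⟨l, x⟩ := v
  rw [isPoint_cap_iff] at hv
  obtain ⟨hl, hx⟩ | ⟨hl, hx⟩ := hv
  · obtain rfl : l = 0 := hl
    obtain hi | hi | hi | hi : x < i ∨ x = i ∨ x = i + 1 ∨ i + 2 ≤ x := by omega
    · apply connected_of_edge
      have hm : x < m := by omega
      simpa [capComponent, capLabel, hi, hm, capRep] using
        hE _ _ (.inl (.cap_left (h := h) x hi))
    · subst hi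
      have e : capRep m x (capComponent m x (0, x)) = (0, x) := by
        simp [capComponent, capLabel, capRep]
      simp only [e]
      exact M.connected.refl _
    · subst hi
      apply M.connected.symm
      apply connected_of_edge
      simpa [capComponent, capLabel, capRep] using hE _ _ (.inl (.cap_arc (h := h)))
    · obtain ⟨x, rfl⟩ : ∃ k, x = k + 2 := ⟨x - 2, by omega⟩
      apply connected_of_edge
      have hm : x < m := by simp at hx; omega
      have h₁ : ¬ x + 2 < i := by omega
      have h₂ : i ≤ x := by omega
      simpa [capComponent, capLabel, h₁, h₂.not_gt, hm, capRep] using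
        hE _ _ (.inl (.cap_right (h := h) x h₂))
  · obtain rfl : l = 1 := hl
    have hm : x < m := hx
    have e : capRep m i (capComponent m i (1, x)) = (1, x) := by
      simp [capComponent, capLabel, capRep, hm]
    simp only [e]
    exact M.connected.refl _

variable (m i h)

/-- The components of the identity of a cap. -/
def capLabelling : (Movie.nil (cap m i h)).Labelling (Option (Fin m)) where
  label p := capComponent m i p.2
  rep l := ⟨(0, capRep m i l), rfl, isPoint_capRep m i h l⟩
  label_rep := capComponent_capRep m i
  label_eq p q hpq := congrArg (Option.bind · _) (capLabel_of_edge_cap m i h hpq.2.2)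
  connected_rep := by
    rintro ⟨⟨t, v⟩, ht, hv⟩
    obtain rfl : t = 0 := ht
    exact connected_capRep (M := .nil (cap m i h)) (fun _ hv => ⟨rfl, hv⟩)
      (fun _ _ hvw => ⟨rfl, rfl, hvw⟩) v hv

/-- Vertical sheets of the saddle and of the death either keep the level or change it by `2`, so
parity is preserved. The arc of the cap and the circle share the label `none`, as they must: the
saddle puts them on one sheet. -/
theorem capLabel_eq_of_snake_edge {p q : ℕ × ℕ × ℕ} (hpq : (snake m i h).Edge p q) :
    capLabel i p.2 = capLabel i q.2 := by
  rcases hpq with ⟨_, _, hpq⟩ | ⟨_, _, hpq⟩ | ⟨p, q, ⟨_, _, hpq⟩ | ⟨_, _, hpq⟩ |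
    ⟨p', q', ⟨_, _, hpq⟩, rfl, rfl⟩, rfl, rfl⟩
  · exact capLabel_of_edge_cap m i h hpq
  · obtain ⟨h₁, ⟨h₂, _⟩ | ⟨k, h₂, h₃⟩⟩ := hpq
    · rw [Prod.ext h₂ h₁]
    · have h₂' : p.2.1 = 0 + 0 + k := h₂
      have h₃' : q.2.1 = 0 + 2 + k := h₃
      have e : p.2.1 % 2 = q.2.1 % 2 := by omega
      simp [capLabel, h₁, e]
  · exact capLabel_of_edge_cap_circ m i h hpq
  · obtain ⟨h₁, ⟨h₂, _⟩ | ⟨k, h₂, h₃⟩⟩ := hpq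
    · exact congrArg _ (Prod.ext h₂ h₁)
    · have h₂' : p.2.1 = 1 + 2 + k := h₂
      have h₃' : q.2.1 = 1 + 0 + k := h₃
      have e : p.2.1 % 2 = q.2.1 % 2 := by omega
      simp [capLabel, h₁, e]
  · exact capLabel_of_edge_cap m i h hpq

theorem isPoint_snake_iff (p : ℕ × ℕ × ℕ) : (snake m i h).IsPoint p ↔
    (p.1 = 0 ∧ (cap m i h).IsPoint p.2) ∨
    (p.1 = 1 ∧ ((cap m i h).comp (circ m i h)).IsPoint p.2) ∨
      (p.1 = 2 ∧ (cap m i h).IsPoint p.2) := by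
  constructor
  · rintro (hp | ⟨q, ⟨h₁, h₂⟩ | ⟨r, ⟨h₁, h₂⟩, rfl⟩, rfl⟩)
    · exact .inl hp
    · exact .inr (.inl ⟨congrArg (· + 1) h₁, h₂⟩)
    · exact .inr (.inr ⟨congrArg (· + 1 + 1) h₁, h₂⟩)
  · obtain ⟨t, v⟩ := p
    rintro (hp | ⟨rfl, hp⟩ | ⟨rfl, hp⟩)
    · exact .inl hp
    · exact .inr ⟨(0, v), .inl ⟨rfl, hp⟩, rfl⟩
    · exact .inr ⟨(1, v), .inr ⟨(0, v), ⟨rfl, hp⟩, rfl⟩, rfl⟩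

theorem snake_connected_zero (v : ℕ × ℕ) (hv : (cap m i h).IsPoint v) :
    (snake m i h).connected ⟨(0, v), .inl ⟨rfl, hv⟩⟩
      ⟨(0, capRep m i (capComponent m i v)), .inl ⟨rfl, isPoint_capRep m i h _⟩⟩ :=
  connected_capRep (M := snake m i h) (fun _ hv => .inl ⟨rfl, hv⟩)
    (fun _ _ hvw => .inl ⟨rfl, rfl, hvw⟩) v hv

/-- Every point of the middle diagram is connected to a chosen point of the first diagram. -/
theorem snake_connected_one (v : ℕ × ℕ) (hv : ((cap m i h).comp (circ m i h)).IsPoint v) :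
    (snake m i h).connected ⟨(1, v), (isPoint_snake_iff m i h _).2 (.inr (.inl ⟨rfl, hv⟩))⟩
      ⟨(0, capRep m i (capComponent m i v)), .inl ⟨rfl, isPoint_capRep m i h _⟩⟩ := by
  obtain ⟨l, x⟩ := v
  -- Levels `0`, `2` and `3` of the middle frame are reached by vertical sheets from levels `0`, `0`
  -- and `1` of the first frame.
  have sheet {l' : ℕ} (hP : (cap m i h).IsPoint (l', x))
      (he : ((Elem.saddle m i h).toMove.right (cap m i h)).Sheet (l', x) (l, x))
      (hl : l' % 2 = l % 2) : (snake m i h).connected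
        ⟨(1, (l, x)), (isPoint_snake_iff m i h _).2 (.inr (.inl ⟨rfl, hv⟩))⟩
        ⟨(0, capRep m i (capComponent m i (l, x))), .inl ⟨rfl, isPoint_capRep m i h _⟩⟩ := by
    have e : capComponent m i (l', x) = capComponent m i (l, x) := by
      simp [capComponent, capLabel, hl]
    have := snake_connected_zero m i h _ hP
    simp only [e] at this
    refine (snake m i h).connected.trans ((snake m i h).connected.symm ?_) this
    exact connected_of_edge (.inr (.inl ⟨rfl, rfl, he⟩))
  have hv' := (isPoint_cap_circ_iff m i h _).1 hv
  obtain ⟨hl, hx⟩ | ⟨hl, hx⟩ | ⟨hl, hx⟩ | ⟨hl, hx⟩ := hv'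
  · obtain rfl : l = 0 := hl
    exact sheet (l' := 0) ((isPoint_cap_iff m i h _).2 (.inl ⟨rfl, hx⟩))
      ⟨rfl, .inl ⟨rfl, le_rfl⟩⟩ rfl
  · obtain rfl : l = 1 := hl
    have hm : x < m := hx
    -- Level `1` lies inside the turnback created by the saddle, where no sheet ends. It is reached
    -- along a strand of the cap from level `0` of the same frame.
    have key (y : ℕ) (hy : (Piece.cap m i h).Edge (0, y) (1, x)) (hy' : y < m + 2) :
        (snake m i h).connected
          ⟨(1, (1, x)), (isPoint_snake_iff m i h _).2 (.inr (.inl ⟨rfl, hv⟩))⟩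
          ⟨(0, capRep m i (capComponent m i (1, x))), .inl ⟨rfl, isPoint_capRep m i h _⟩⟩ := by
      have e : capComponent m i (0, y) = capComponent m i (1, x) :=
        congrArg (Option.bind · _) (capLabel_eq_of_edge m i h hy 0)
      have h₀ : (cap m i h).IsPoint (0, y) := (isPoint_cap_iff m i h _).2 (.inl ⟨rfl, hy'⟩)
      have := snake_connected_zero m i h _ h₀
      simp only [e] at this
      have h₁ : (snake m i h).IsPoint (1, (0, y)) := (isPoint_snake_iff m i h _).2
        (.inr (.inl ⟨rfl, (isPoint_cap_circ_iff m i h _).2 (.inl ⟨rfl, hy'⟩)⟩))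
      refine (snake m i h).connected.trans (b := ⟨(1, (0, y)), h₁⟩)
        ((snake m i h).connected.symm ?_)
        ((snake m i h).connected.trans ((snake m i h).connected.symm ?_) this)
      · exact connected_of_edge (.inr (.inr ⟨(0, (0, y)), (0, (1, x)),
          .inl ⟨rfl, rfl, .inl hy⟩, rfl, rfl⟩))
      · exact connected_of_edge (.inr (.inl ⟨rfl, rfl, rfl, .inl ⟨rfl, le_rfl⟩⟩))
    obtain hi | hi := lt_or_ge x i
    · exact key x (.cap_left x hi) (by omega)
    · exact key (x + 2) (.cap_right x hi) (by omega)
  · obtain rfl : l = 2 := hl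
    exact sheet (l' := 0) ((isPoint_cap_iff m i h _).2 (.inl ⟨rfl, hx⟩))
      ⟨rfl, .inr ⟨0, rfl, rfl⟩⟩ rfl
  · obtain rfl : l = 3 := hl
    exact sheet (l' := 1) ((isPoint_cap_iff m i h _).2 (.inr ⟨rfl, hx⟩))
      ⟨rfl, .inr ⟨1, rfl, rfl⟩⟩ rfl

/-- The components of the snake. -/
def snakeLabelling : (snake m i h).Labelling (Option (Fin m)) where
  label p := capComponent m i p.2
  rep l := ⟨(0, capRep m i l), .inl ⟨rfl, isPoint_capRep m i h l⟩⟩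
  label_rep := capComponent_capRep m i
  label_eq p q hpq := congrArg (Option.bind · _) (capLabel_eq_of_snake_edge m i h hpq)
  connected_rep := by
    rintro ⟨⟨t, v⟩, hp⟩
    obtain ⟨ht, hv⟩ | ⟨ht, hv⟩ | ⟨ht, hv⟩ := (isPoint_snake_iff m i h _).1 hp
    · obtain rfl : t = 0 := ht
      exact snake_connected_zero m i h v hv
    · obtain rfl : t = 1 := ht
      exact snake_connected_one m i h v hv
    · obtain rfl : t = 2 := ht
      have hv₁ : ((cap m i h).comp (circ m i h)).IsPoint v := by
        have hv' := (isPoint_cap_iff m i h v).1 hv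
        rw [isPoint_cap_circ_iff]
        omega
      refine (snake m i h).connected.trans ((snake m i h).connected.symm ?_)
        (snake_connected_one m i h v hv₁)
      refine connected_of_edge (.inr (.inr ⟨(0, v), (1, v), .inr (.inl ⟨rfl, rfl, rfl,
        .inl ⟨rfl, ?_⟩⟩), rfl, rfl⟩))
      change v.1 ≤ 1
      have hv' := (isPoint_cap_iff m i h v).1 hv
      omega

/-- The saddle and the death lie on the same component, the one through the arc, and their Euler
characteristics `-1` and `1` cancel. All other components carry no weight. -/
theorem snake_homeomorphic : (snake m i h).Homeomorphic (.nil (cap m i h)) := by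
  refine Movie.Labelling.homeomorphic (snakeLabelling m i h) (capLabelling m i h)
    (fun v hv => .inl ⟨rfl, hv⟩) (fun v hv => ⟨rfl, hv⟩)
    (fun v hv => (isPoint_snake_iff m i h _).2 (.inr (.inr ⟨rfl, hv⟩))) (fun v hv => ⟨rfl, hv⟩)
    (fun _ _ => rfl) (fun _ _ => rfl) fun κ κ' _ => ?_
  have h₁ : κ.Contains (0, 0, i) ↔ none = (snakeLabelling m i h).equiv κ := by
    rw [(snakeLabelling m i h).contains_iff]
    refine (and_iff_right ?_).trans (Eq.congr_left ?_)
    · exact .inl ⟨rfl, isPoint_capRep m i h none⟩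
    · exact capComponent_capRep m i none
  have h₂ : κ.Contains (1, 2, i) ↔ none = (snakeLabelling m i h).equiv κ := by
    rw [(snakeLabelling m i h).contains_iff]
    refine (and_iff_right ?_).trans (Eq.congr_left ?_)
    · rw [isPoint_snake_iff]
      refine .inr (.inl ⟨rfl, (isPoint_cap_circ_iff m i h _).2 (.inr (.inr (.inl ⟨rfl, ?_⟩)))⟩)
      change i < m + 2
      omega
    · exact (congrArg (Option.bind · _) (by simp [capLabel, capRep])).trans
        (capComponent_capRep m i none)
  have hM : (snake m i h).marks = [((0, 0, i), (-1, 0)), ((1, 2, i), (1, 0))] := rfl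
  have hN : (Movie.nil (cap m i h)).marks = [] := rfl
  rw [Movie.Component.weight, Movie.Component.weight, hM, hN]
  by_cases hκ : none = (snakeLabelling m i h).equiv κ
  · simp [List.filter, h₁.2 hκ, h₂.2 hκ]
    rfl
  · simp [List.filter, mt h₁.1 hκ, mt h₂.1 hκ]

theorem cls_snake : cls (snake m i h) = cls (.nil (cap m i h)) :=
  cls_eq_of_relator (.homeo _ _ (snake_homeomorphic m i h))

end

/-! ### Complexes killed by a turnback -/

section

universe v u u₁

variable {A : Type u} [Category.{v} A] [Preadditive A] {B : Type u₁} [Category.{v} B]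
  [Preadditive B]

/-- Naturality gives `φ = η ≫ S(F φ) ≫ ε`. The contraction of `F K` writes `F φ` as `F d ≫ s ≫ F φ`,
the other term dying because `φ` is a cocycle; naturality of `η` then pulls `d` out in front. The
retraction `ε` is needed only at `Z` and need not be natural. -/
theorem homExact_of_retract (F : A ⥤ B) [F.Additive] (S : B ⥤ A) (η : 𝟭 A ⟶ F ⋙ S)
    {K : CochainComplex A ℤ}
    (hK : Homotopy (𝟙 ((F.mapHomologicalComplex (ComplexShape.up ℤ)).obj K)) 0)
    {Z : A} (ε : S.obj (F.obj Z) ⟶ Z) (hε : η.app Z ≫ ε = 𝟙 Z) : HomExact K Z := by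
  intro p φ hφ
  refine ⟨η.app _ ≫ S.map
    ((hK.hom (p + 1) p : F.obj (K.X (p + 1)) ⟶ F.obj (K.X p)) ≫ F.map φ) ≫ ε, ?_⟩
  have hc := hK.comm p
  rw [dNext_eq hK.hom (show (ComplexShape.up ℤ).Rel p (p + 1) from rfl),
    prevD_eq hK.hom (show (ComplexShape.up ℤ).Rel (p - 1) p from sub_add_cancel p 1)] at hc
  let s : F.obj (K.X (p + 1)) ⟶ F.obj (K.X p) := hK.hom (p + 1) p
  let t : F.obj (K.X p) ⟶ F.obj (K.X (p - 1)) := hK.hom p (p - 1)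
  have hc' : 𝟙 (F.obj (K.X p)) = F.map (K.d p (p + 1)) ≫ s + t ≫ F.map (K.d (p - 1) p) :=
    hc.trans (add_zero _)
  have h' : F.map (K.d p (p + 1)) ≫ s ≫ F.map φ = F.map φ := by
    have := congrArg (· ≫ F.map φ) hc'
    simp only [Preadditive.add_comp, Category.assoc, ← F.map_comp, hφ, Category.id_comp] at this
    simpa using this.symm
  have hd := η.naturality (K.d p (p + 1))
  have hφ' := η.naturality φ
  simp only [Functor.id_map, Functor.comp_map, Functor.id_obj, Functor.comp_obj] at hd hφ'
  change K.d p (p + 1) ≫ η.app _ ≫ S.map (s ≫ F.map φ) ≫ ε = φ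
  rw [← Category.assoc, hd, Category.assoc, ← Category.assoc (S.map _), ← S.map_comp, h',
    ← Category.assoc, ← hφ', Category.assoc, hε, Category.comp_id]

/-- The extension of a natural transformation to formal direct sums. -/
def mapMatNatTrans {F G : A ⥤ B} [F.Additive] [G.Additive] (α : F ⟶ G) :
    F.mapMat_ ⟶ G.mapMat_ where
  -- A diagonal matrix, with the identity matrix of `M` serving as Kronecker delta, so that no
  -- comparison of indices is needed.
  app M := fun i j => α.app (M.X i) ≫ G.map ((𝟙 M : M ⟶ M) i j)
  naturality M N f := by
    apply Mat_.hom_ext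
    intro i k
    change ∑ j, F.map (f i j) ≫ α.app (N.X j) ≫ G.map ((𝟙 N : N ⟶ N) j k) =
      ∑ j, (α.app (M.X i) ≫ G.map ((𝟙 M : M ⟶ M) i j)) ≫ G.map (f j k)
    simp only [Category.assoc, ← G.map_comp, ← Preadditive.comp_sum, ← G.map_sum,
      α.naturality_assoc]
    have h₁ : ∑ j, (𝟙 M : M ⟶ M) i j ≫ f j k = f i k := congrFun₂ (Category.id_comp f) i k
    have h₂ : ∑ j, f i j ≫ (𝟙 N : N ⟶ N) j k = f i k := congrFun₂ (Category.comp_id f) i k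
    rw [h₁, h₂]

theorem mapMatNatTrans_app_embedding {F G : A ⥤ B} [F.Additive] [G.Additive] (α : F ⟶ G) (X : A) :
    (mapMatNatTrans α).app ((Mat_.embedding A).obj X) = (Mat_.embedding B).map (α.app X) := by
  apply Mat_.hom_ext
  rintro ⟨⟩ ⟨⟩
  have h : (𝟙 ((Mat_.embedding A).obj X) : _ ⟶ _) PUnit.unit PUnit.unit = 𝟙 X :=
    Mat_.id_apply_self _ _
  exact (congrArg (fun f => α.app X ≫ G.map f) h).trans
    ((congrArg (_ ≫ ·) (G.map_id X)).trans (Category.comp_id _))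

end

section

variable {a b : ℕ}

/-- A move on the strands in front of a diagram takes place away from any cobordism of that diagram.
By linearity and induction on the movie this reduces to exchanging two moves. -/
theorem cobComp_elem_natural {U : Diag a a} (s : Elem (.nil a) U) {D E : Diag a b}
    (f : CobHom D E) :
    cobComp D E (U.comp E) f (cls (s.toMove.right E).movie) =
      cobComp D (U.comp D) (U.comp E) (cls (s.toMove.right D).movie) (cobLeft U D E f) := by
  induction f using cobHom_induction with
  | zero => simp
  | add f g hf hg => simp only [map_add, LinearMap.add_apply, hf, hg]
  | smul r M =>
    simp only [map_smul, LinearMap.smul_apply, cobLeft_cls]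
    congr 1
    induction M with
    | nil D => exact (cls_nil_comp _).trans (comp_cls_nil _).symm
    | @cons D E F t M ih =>
      have h₁ : cls (.cons t M) = cobComp D E F (cls t.movie) (cls M) :=
        (cobComp_cls t.movie M).symm
      have h₂ : cls (Movie.left U (.cons t M)) =
          cobComp (U.comp D) (U.comp E) (U.comp F) (cls (t.left U).movie) (cls (M.left U)) :=
        (cobComp_cls (t.left U).movie (M.left U)).symm
      have h₃ : cobComp D (U.comp D) (U.comp E) (cls (s.toMove.right D).movie)
          (cls (t.left U).movie) =
          cobComp D E (U.comp E) (cls t.movie) (cls (s.toMove.right E).movie) :=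
        (cobComp_cls _ _).trans ((cls_eq_of_relator (.interchange s.toMove t)).trans
          (cobComp_cls _ _).symm)
      rw [h₁, h₂, cobComp_assoc, ih, ← cobComp_assoc, ← cobComp_assoc, h₃]

end

/-! ### Saddle and death in the graded category; acyclicity for diagrams beginning with a cap. -/

variable {n : ℕ}

/-- The shift of the `q`-degree. -/
def qShift (n : ℕ) (s : ℤ) : Cob n ⥤ Cob n where
  obj A := ⟨A.diag, A.q + s⟩
  map {A B} f := ⟨f.1, by rw [add_sub_add_right_eq_sub]; exact f.2⟩
  map_id _ := rfl
  map_comp _ _ := rfl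

instance (s : ℤ) : (qShift n s).Additive where
  map_add := rfl

/-- A movie as a morphism of degree zero. -/
def movieHom {A B : Cob n} (M : Movie A.diag B.diag) (h : M.deg = A.q - B.q) : A ⟶ B :=
  ⟨cls M, h ▸ cls_mem_homogeneous M⟩

/-- The saddles from `A` to `e ⊗ A`, for a turnback `e`. -/
def saddleNatTrans (m i : ℕ) (h : i ≤ m) :
    𝟭 (Cob (m + 2)) ⟶ stackLeft (turnback m i h) ⋙ qShift (m + 2) 1 where
  app A := movieHom (B := ⟨(turnback m i h).comp A.diag, A.q + 1⟩)
    ((Elem.saddle m i h).toMove.right A.diag).movie (by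
      change (-1 - 2 * 0 + 0 : ℤ) = A.q - (A.q + 1)
      ring)
  naturality _ _ f := Subtype.ext (cobComp_elem_natural (Elem.saddle m i h) f.1)

/-- The death of the circle in `e ⊗ A`, where `e` is a turnback and `A` begins with the same
cap. -/
def deathHom {m i : ℕ} (h : i ≤ m) (V : Diag m (m + 2)) (q : ℤ) :
    (qShift (m + 2) 1).obj ((stackLeft (turnback m i h)).obj ⟨(cap m i h).comp V, q⟩) ⟶
      (⟨(cap m i h).comp V, q⟩ : Cob (m + 2)) :=
  movieHom (A := ⟨(turnback m i h).comp ((cap m i h).comp V), q + 1⟩)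
    (((Elem.death m i h).toMove.left (cap m i h)).right V).movie (by
      change (1 - 2 * 0 + 0 : ℤ) = q + 1 - q
      ring)

/-- This is the snake identity for a bare cap, glued with the identity of the rest `V` of the
diagram. -/
theorem saddle_death {m i : ℕ} (h : i ≤ m) (V : Diag m (m + 2)) (q : ℤ) :
    (saddleNatTrans m i h).app ⟨(cap m i h).comp V, q⟩ ≫ deathHom h V q = 𝟙 _ := by
  refine Subtype.ext ?_
  refine (cobComp_cls _ _).trans ?_
  have := congrArg (cobRight _ _ V) (cls_snake m i h)
  rw [cobRight_cls, cobRight_cls] at this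
  exact this

theorem homotopy_id_zero {K : CochainComplex (MatCob n) ℤ} (h : IsContractible K) :
    Nonempty (Homotopy (𝟙 K) 0) := by
  obtain ⟨e⟩ := h
  refine ⟨e.homotopyHomInvId.symm.trans (Homotopy.ofEq ?_)⟩
  rw [(isZero_zero _).eq_of_tgt e.hom 0, zero_comp]

theorem homExact_of_startsWithCap {K : CochainComplex (MatCob n) ℤ}
    (hK : ∀ (i : ℕ) (h₀ : 0 < i) (h₁ : i < n), IsContractible (tensorLeft (gen n i h₀ h₁) K))
    {D : Diag n n} (hD : StartsWithCap D) (q : ℤ) :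
    HomExact K ((Mat_.embedding (Cob n)).obj ⟨D, q⟩) := by
  cases hD with
  | @cons m i _ h V =>
    -- The cap at position `i`, counted from `0`, belongs to the generator of index `i + 1`, counted
    -- from `1`.
    obtain ⟨s⟩ := homotopy_id_zero (hK (i + 1) (Nat.succ_pos i) (by omega))
    refine homExact_of_retract (stackLeft (turnback m i h)).mapMat_ (qShift (m + 2) 1).mapMat_
      (mapMatNatTrans (F := 𝟭 _) (saddleNatTrans m i h)) s
      ((Mat_.embedding (Cob (m + 2))).map (deathHom h V q)) ?_
    refine (congrArg (· ≫ (Mat_.embedding (Cob (m + 2))).map (deathHom h V q))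
      (mapMatNatTrans_app_embedding (F := 𝟭 _) (saddleNatTrans m i h)
        ⟨(cap m i h).comp V, q⟩)).trans ?_
    refine ((Mat_.embedding (Cob (m + 2))).map_comp _ _).symm.trans ?_
    rw [saddle_death]
    exact CategoryTheory.Functor.map_id _ _

/-! ### Summands in `Mat(Cob(n))` and the identity diagram. -/

/-- The projections of a splitting, as maps of degree zero. -/
def Splitting.projHom {W W' : Diag n n} (S : Splitting W W') (q : ℤ) (k : S.ι) :
    (⟨W, q⟩ : Cob n) ⟶ ⟨W', q - S.d k⟩ :=
  ⟨S.proj k, by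
    change _ ∈ homogeneous _ _ (q - (q - S.d k))
    rw [sub_sub_cancel]
    exact S.proj_mem k⟩

/-- The inclusions of a splitting, as maps of degree zero. -/
def Splitting.inclHom {W W' : Diag n n} (S : Splitting W W') (q : ℤ) (k : S.ι) :
    (⟨W', q - S.d k⟩ : Cob n) ⟶ ⟨W, q⟩ :=
  ⟨S.incl k, by
    change _ ∈ homogeneous _ _ (q - S.d k - q)
    rw [sub_sub_cancel_left]
    exact S.incl_mem k⟩

theorem Splitting.sum_projHom_inclHom {W W' : Diag n n} (S : Splitting W W') (q : ℤ) :
    ∑ k, S.projHom q k ≫ S.inclHom q k = 𝟙 (⟨W, q⟩ : Cob n) := by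
  refine Subtype.ext ?_
  refine (AddSubgroup.val_finsetSum _ _ _).trans ?_
  exact S.total

theorem Splitting.embedding_system {W W' : Diag n n} (S : Splitting W W') (q : ℤ) :
    (∑ k, (Mat_.embedding (Cob n)).map (S.projHom q k) ≫
        (Mat_.embedding (Cob n)).map (S.inclHom q k) = 𝟙 _) ∧
      (∀ k, (Mat_.embedding (Cob n)).map (S.inclHom q k) ≫
        (Mat_.embedding (Cob n)).map (S.projHom q k) = 𝟙 _) ∧
      ∀ k l, k ≠ l → (Mat_.embedding (Cob n)).map (S.inclHom q k) ≫
        (Mat_.embedding (Cob n)).map (S.projHom q l) = 0 := by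
  refine ⟨?_, fun k => ?_, fun k l hkl => ?_⟩
  · simp only [← Functor.map_comp, ← Functor.map_sum, S.sum_projHom_inclHom,
      CategoryTheory.Functor.map_id]
  · have : S.inclHom q k ≫ S.projHom q k = 𝟙 _ := Subtype.ext (S.self k)
    rw [← Functor.map_comp, this, CategoryTheory.Functor.map_id]
  · have : S.inclHom q k ≫ S.projHom q l = 0 := Subtype.ext (S.ne k l hkl)
    rw [← Functor.map_comp, this, CategoryTheory.Functor.map_zero]

/-- The projection of a formal direct sum to a summand. -/
def summandProj (Z : MatCob n) (s : Z.ι) : Z ⟶ (Mat_.embedding (Cob n)).obj (Z.X s) :=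
  Z.isoBiproductEmbedding.hom ≫ biproduct.π _ s

/-- The inclusion of a summand of a formal direct sum. -/
def summandIncl (Z : MatCob n) (s : Z.ι) : (Mat_.embedding (Cob n)).obj (Z.X s) ⟶ Z :=
  biproduct.ι (fun s => (Mat_.embedding (Cob n)).obj (Z.X s)) s ≫ Z.isoBiproductEmbedding.inv

theorem sum_summandProj_summandIncl (Z : MatCob n) :
    ∑ s, summandProj Z s ≫ summandIncl Z s = 𝟙 Z := by
  have h (s : Z.ι) : summandProj Z s ≫ summandIncl Z s = Z.isoBiproductEmbedding.hom ≫
      (biproduct.π (fun s => (Mat_.embedding (Cob n)).obj (Z.X s)) s ≫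
        biproduct.ι (fun s => (Mat_.embedding (Cob n)).obj (Z.X s)) s) ≫
          Z.isoBiproductEmbedding.inv := by
    simp only [summandProj, summandIncl, Category.assoc]
  simp_rw [h, ← Preadditive.comp_sum, ← Preadditive.sum_comp, biproduct.total, Category.id_comp,
    Iso.hom_inv_id]

/-- The summand splits off `Z`, and a shifted identity splits off the summand. The second step uses
that the index type of a splitting is nonempty. -/
theorem exists_iso_unit_biprod (Z : MatCob n) (s : Z.ι) (S : Splitting (Z.X s).diag (.nil n)) :
    ∃ (j : ℤ) (D : MatCob n), Nonempty (Z ≅ unit n j ⊞ D) := by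
  classical
  obtain ⟨D₁, ⟨e₁⟩⟩ := nonempty_iso_biprod (summandProj Z) (summandIncl Z)
    (sum_summandProj_summandIncl Z) (fun s => by
      rw [summandProj, summandIncl, Category.assoc, Iso.inv_hom_id_assoc, biproduct.ι_π_self])
    (fun s t hst => by
      rw [summandProj, summandIncl, Category.assoc, Iso.inv_hom_id_assoc,
        biproduct.ι_π_ne _ hst]) s
  obtain ⟨h₁, h₂, h₃⟩ := S.embedding_system (Z.X s).q
  obtain ⟨k⟩ := S.nonempty
  obtain ⟨D₂, ⟨e₂⟩⟩ := nonempty_iso_biprod _ _ h₁ h₂ h₃ k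
  exact ⟨_, D₂ ⊞ D₁, ⟨e₁ ≪≫ biprod.mapIso e₂ (Iso.refl D₁) ≪≫ biprod.associator _ _ _⟩⟩

/-- Exactness is tested on the summands of `Q_k` and then on their normal forms. A normal form equal
to the identity contradicts the condition on `Q_k`; every other one begins with a cap, and the
corresponding turnback kills `P`. -/
theorem IsUniversalProjector.homExact {P Q : Kom n} (hP : IsUniversalProjector P)
    (hQ : IsUniversalProjector Q) (k : ℤ) (hk : k > 0) : HomExact P.obj (Q.obj.X k) := by
  refine HomExact.of_sum _ _ (sum_summandProj_summandIncl _) fun s => ?_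
  obtain ⟨W, ⟨S⟩, hW⟩ := exists_splitting_isNormal ((Q.obj.X k).X s).diag
  obtain rfl | hW := hW.eq_nil_or
  · obtain ⟨j, D, ⟨e⟩⟩ := exists_iso_unit_biprod _ s S
    exact ((hQ.not_iso k hk j D).false e).elim
  · exact HomExact.of_sum _ _ (S.embedding_system ((Q.obj.X k).X s).q).1 fun i =>
      homExact_of_startsWithCap hP.left_contractible hW _

end BarNatan

end

theorem corollary3p5 (n : ℕ) (C D : BarNatan.Kom n)
    (hC : BarNatan.IsUniversalProjector C) (hD : BarNatan.IsUniversalProjector D) :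
    Nonempty (HomotopyEquiv C.obj D.obj) := by
  obtain ⟨e⟩ := hC.zero_iso
  obtain ⟨e'⟩ := hD.zero_iso
  exact BarNatan.nonempty_homotopyEquiv hC.isZero_of_neg hD.isZero_of_neg (hC.homExact hC)
    (hC.homExact hD) (hD.homExact hC) (hD.homExact hD) (e.trans e'.symm)
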